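/- Fix constants $\gamma>0$, $A\ge 0$, $0<c_1\le c_2$, $0<b_1\le b_2$. Let $n,m,d$ be positive integers with $c_1d^{1/20}\le n\le c_2 d^{1/20}$ (that is, $n=\Theta(d^{1/20})$), $n\le d$ and $m\ge n$, and let $e_1,\dots,e_d$ be the standard basis of $\mathbb R^d$. **Data.** There are $2n$ classes and $n$ clients. For $i\in[n]$, a sample of class $2i-1$ (respectively $2i$) is distributed as $$x=e_i-\sum_{j\in[n],\,j\ne i}\tau q_je_j+\mu\xi\qquad\Bigl(\text{respectively } x=-e_i-\sum_{j\in[n],\,j\ne i}\tau q_je_j+\mu\xi\Bigr),$$ with $\tau=d^{1/5}$, $\mu=d^{-1/5}$, independent $q_j$ uniform on $\{-1,1\}$ and an independent $\xi\sim\mathcal N(0,I_d)$. Client $k$ holds a data set $D_k$ of $|D_k|\ge d^{2+\gamma}$ samples with given labels, of which at most $A\,d^{-4/5}|D_k|$ are outside the two classes $2k-1,2k$. All samples of all clients are independent, $|D|=\sum_k|D_k|$, and $b_1/n\le |D_k|/|D|\le b_2/n$ for every $k$. **Objectives.** For $w\in\mathbb R^{m\times d}$ let $$\mathcal L_k(w)=-\mathbb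 E\bigl[(wx+\zeta)^T(wx+\zeta')\bigr]+\tfrac12\|w^Tw\|_F^2,\qquad \mathcal L(w)=\sum_{k=1}^n\frac{|D_k|}{|D|}\mathcal L_k(w),$$ where in $\mathcal L_k$ the point $x$ is uniform on the sample $D_k$ and, independently of $x$, $(\zeta,\zeta')$ is a pair of integrable, mean-zero noise vectors in $\mathbb R^m$ (whose law may depend on $k$) with $\zeta^T\zeta'$ integrable. For $w\in\mathbb R^{m\times d}$ with row space $\mathcal S$, the representability vector of $w$ is $r(w)=(r_1,\dots,r_d)$ with $r_i=\|\Pi_{\mathcal S}e_i\|^2$, where $\Pi_{\mathcal S}$ is the orthogonal projection onto $\mathcal S$. Below, $\|\cdot\|$ of a matrix is the spectral norm. **Claim.** There are constants $0<a\le b$, $C>0$ and $d_0$, depending only on $\gamma,A,c_1,c_2,b_1,b_2$, such that for all $d\ge d_0$ the following holds. (1) For every client $k$, with probability at least $1-Cd^{-\gamma}$: for every minimizer $w_k^*$ of $\mathcal L_k$, every $\epsilon\in\mathbb R^{m\times d}$ and every $i\in[n]\setminus\{k\}$, the representability vector $r^k=r(w_k^*+\epsilon)$ satisfies $$\frac{d^{2/5}-Cd^{-2/5}+2e_i^T(w_k^*)^T\epsilon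 e_i+\|\epsilon e_i\|^2}{d^{2/5}+Cd^{-2/5}+\|2(w_k^*)^T\epsilon+\epsilon^T\epsilon\|}\le r_i^k\le 1 .$$ (2) $d^{2/5}-a\,d^{7/20}+Cd^{-1/20}>0$, and with probability at least $1-Cd^{-\gamma}$: for every minimizer $w^*$ of $\mathcal L$, every $\epsilon_1\in\mathbb R^{m\times d}$ and every $i\in[n]$, the representability vector $\bar r=r(w^*+\epsilon_1)$ satisfies $$\frac{d^{2/5}-b\,d^{7/20}-Cd^{-1/20}-Cd^{-2/5}+2e_i^T(w^*)^T\epsilon_1e_i+\|\epsilon_1e_i\|^2}{d^{2/5}-a\,d^{7/20}+Cd^{-1/20}+\|2(w^*)^T\epsilon_1+\epsilon_1^T\epsilon_1\|}\le\bar r_i\le 1 .$$ (If one of the events is not measurable, the claim is that its complement has outer probability at most $Cd^{-\gamma}$.) -/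

import Mathlib

open MeasureTheory ProbabilityTheory
open scoped Matrix InnerProductSpace

noncomputable section

namespace FedSSL

/-- The direction (in `[n]`) attached to a class. The `2 n` classes are numbered from `0`: the classes
`2 i` and `2 i + 1` (that is, the classes `2 k - 1` and `2 k` in counting from one) carry the features
`e_i` and `- e_i`. -/
def classDir {n : ℕ} (c : Fin (2 * n)) : Fin n := ⟨c.val / 2, by omega⟩

/-- The sign of the feature of a class. -/
def classSign {n : ℕ} (c : Fin (2 * n)) : ℝ := (-1) ^ (c.val % 2)

/-- The standard basis vector `e_i` of `ℝ^d`, for `i` one of the first `n` indices. -/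
def basisVec {n d : ℕ} (h : n ≤ d) (i : Fin n) : EuclideanSpace ℝ (Fin d) :=
  EuclideanSpace.single (Fin.castLE h i) (1 : ℝ)

/-- The uniform law on `{-1, 1}`. -/
def signLaw : Measure ℝ :=
  ENNReal.ofReal (1 / 2) • Measure.dirac (1 : ℝ) + ENNReal.ofReal (1 / 2) • Measure.dirac (-1 : ℝ)

/-- A data point of class `c`, as a function of the nuisance coefficients `q` and the noise `ξ`:
`± e_i - ∑_{j ≠ i} τ q_j e_j + μ ξ` with `i` the direction of `c`, `τ = d^{1/5}`, `μ = d^{-1/5}`. -/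
def classPoint {n d : ℕ} (h : n ≤ d) (c : Fin (2 * n)) (p : (Fin n → ℝ) × (Fin d → ℝ)) :
    EuclideanSpace ℝ (Fin d) :=
  classSign c • basisVec h (classDir c)
    - ∑ j ∈ Finset.univ.erase (classDir c), ((d : ℝ) ^ (1 / 5 : ℝ) * p.1 j) • basisVec h j
    + (d : ℝ) ^ (-(1 / 5) : ℝ) • WithLp.toLp 2 p.2

/-- The law of a data point of class `c`: independent fair signs `q_j` and independent standard
Gaussian noise `ξ`. -/
def classLaw {n d : ℕ} (h : n ≤ d) (c : Fin (2 * n)) : Measure (EuclideanSpace ℝ (Fin d)) :=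
  ((Measure.pi fun _ : Fin n => signLaw).prod (Measure.pi fun _ : Fin d => gaussianReal 0 1)).map
    (classPoint h c)

/-- The number of samples of a client with labels `y` that are not of the two classes of
direction `k`. -/
def offClassCount {n N : ℕ} (k : Fin n) (y : Fin N → Fin (2 * n)) : ℕ :=
  (Finset.univ.filter fun s => classDir (y s) ≠ k).card

/-- A pair `(ξ, ξ')` of centered random noise vectors in the feature space, given by its law. -/
structure IsCenteredNoise {m : ℕ}
    (π : Measure (EuclideanSpace ℝ (Fin m) × EuclideanSpace ℝ (Fin m))) : Prop where
  prob : IsProbabilityMeasure π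
  integrable_fst : Integrable (fun p => p.1) π
  integrable_snd : Integrable (fun p => p.2) π
  mean_fst : ∫ p, p.1 ∂π = 0
  mean_snd : ∫ p, p.2 ∂π = 0
  integrable_inner : Integrable (fun p => ⟪p.1, p.2⟫_ℝ) π

/-- The squared Frobenius norm. -/
def frobSq {d : ℕ} (M : Matrix (Fin d) (Fin d) ℝ) : ℝ := ∑ i, ∑ j, M i j ^ 2

/-- The spectral (`ℓ²` operator) norm. -/
def specNorm {d : ℕ} (M : Matrix (Fin d) (Fin d) ℝ) : ℝ :=
  ‖Matrix.toEuclideanCLM (n := Fin d) (𝕜 := ℝ) M‖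

/-- The local objective
`- E [(w x + ξ)ᵀ (w x + ξ')] + 1/2 ‖wᵀ w‖_F²`, where `x` is drawn uniformly from the
local data set and `(ξ, ξ')` has law `π`. -/
def localLoss {m d N : ℕ} (π : Measure (EuclideanSpace ℝ (Fin m) × EuclideanSpace ℝ (Fin m)))
    (x : Fin N → EuclideanSpace ℝ (Fin d)) (w : Matrix (Fin m) (Fin d) ℝ) : ℝ :=
  -((1 / (N : ℝ)) * ∑ s, ∫ p, ⟪Matrix.toEuclideanLin w (x s) + p.1,
      Matrix.toEuclideanLin w (x s) + p.2⟫_ℝ ∂π)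
    + (1 / 2) * frobSq (wᵀ * w)

/-- The global objective, the average of the local ones with weights `|D_k| / |D|`. -/
def globalLoss {m d n : ℕ} {N : Fin n → ℕ}
    (π : Fin n → Measure (EuclideanSpace ℝ (Fin m) × EuclideanSpace ℝ (Fin m)))
    (x : (k : Fin n) → Fin (N k) → EuclideanSpace ℝ (Fin d)) (w : Matrix (Fin m) (Fin d) ℝ) : ℝ :=
  ∑ k, ((N k : ℝ) / ∑ l, (N l : ℝ)) * localLoss (π k) (x k) w

/-- `w` is a global minimizer of `L`. -/
def IsOptimal {m d : ℕ} (L : Matrix (Fin m) (Fin d) ℝ → ℝ) (w : Matrix (Fin m) (Fin d) ℝ) : Prop :=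
  ∀ v, L w ≤ L v

/-- The representability `r_i = ‖Π_S e_i‖²`, with `S` the span of the rows of `w`. -/
def representability {m d : ℕ} (w : Matrix (Fin m) (Fin d) ℝ) (i : Fin d) : ℝ :=
  ‖(Submodule.span ℝ (Set.range fun l : Fin m => (WithLp.toLp 2 (w l) : EuclideanSpace ℝ (Fin d)))
    ).starProjection (EuclideanSpace.single i (1 : ℝ))‖ ^ 2

/-- The perturbation `2 e_jᵀ wᵀ ε e_j + ‖ε e_j‖²`. -/
def diagPerturbation {m d : ℕ} (w ε : Matrix (Fin m) (Fin d) ℝ) (j : Fin d) : ℝ :=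
  2 * (wᵀ * ε) j j + ∑ l, ε l j ^ 2

/-- The perturbation `‖2 wᵀ ε + εᵀ ε‖`. -/
def normPerturbation {m d : ℕ} (w ε : Matrix (Fin m) (Fin d) ℝ) : ℝ :=
  specNorm ((2 : ℝ) • (wᵀ * ε) + εᵀ * ε)

end FedSSL

end

/-! The noise pair is centred and independent of the data, so each objective equals, up to a
constant, -tr(XG) + ½ tr(G²), where G = wᵀw and X is the empirical second moment matrix (pooled over
all clients for the global objective). Two facts about a minimizer matter: ‖G‖ ≤ ‖X‖, and G loses
little of the diagonal of X. Both come from the critical point equation wX = wG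
(`IsOptimal.mul_eq_mul_gram`), the second also from an exchange of eigenvectors
(`IsOptimal.eigenvalue_le`): since w has m ≥ n rows, X - G is bounded above by any nonnegative bound
for X on the vectors vanishing on the first n coordinates (`IsOptimal.residual_le`).

Write τ² = d^{2/5} and μ² = d^{-2/5}. The expectation of X is diagonal, with entry μ² + τ² - f_j(τ²
- 1) at j among the first n, where f_j is the fraction of samples of direction j, and μ² at the
other coordinates. Markov's inequality for the squared Frobenius error makes that error smaller than
μ² outside an event of probability O(d^{-γ}). Off this event the argument is deterministic, hence
uniform in the minimizer and in ε. For a local model f_i = O(d^{-4/5}) when i ≠ k, so the loss is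
O(μ²). For the global model f_j has order 1/n, that is d^{-1/20}, which costs order d^{7/20}.

Finally, for v = w + ε, projecting e_i to the row space of v does not change v e_i. Hence (vᵀv)_ii ≤
‖vᵀv‖ r_i (`gram_diag_le_representability`), and bounds on G become bounds on r_i. -/

noncomputable section

namespace FedSSL

/-! ### Minimizers of the quadratic-quartic objective. -/

/-- The quadratic-quartic objective `-tr (X wᵀ w) + 1/2 tr ((wᵀ w)²)`. -/
def gramLoss {m d : ℕ} (X : Matrix (Fin d) (Fin d) ℝ) (w : Matrix (Fin m) (Fin d) ℝ) : ℝ :=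
  -(X * (wᵀ * w)).trace + (1 / 2) * ((wᵀ * w) * (wᵀ * w)).trace

/-- The quartic vanishes at its minimum t = 0, so its derivative there is zero. This extracts the
first-order condition from optimality along a line. -/
theorem linear_coeff_eq_zero_of_quartic_nonneg {a b c e : ℝ}
    (h : ∀ t : ℝ, 0 ≤ a * t + b * t ^ 2 + c * t ^ 3 + e * t ^ 4) : a = 0 := by
  have hd : HasDerivAt (fun t : ℝ => a * t + b * t ^ 2 + c * t ^ 3 + e * t ^ 4) a 0 := by
    have h1 := ((((hasDerivAt_id (0 : ℝ)).const_mul a).add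
      ((hasDerivAt_pow 2 (0 : ℝ)).const_mul b)).add
      ((hasDerivAt_pow 3 (0 : ℝ)).const_mul c)).add ((hasDerivAt_pow 4 (0 : ℝ)).const_mul e)
    convert! h1 using 1
    simp
  have hm : IsLocalMin (fun t : ℝ => a * t + b * t ^ 2 + c * t ^ 3 + e * t ^ 4) 0 := by
    refine Filter.Eventually.of_forall fun t => ?_
    simpa using h t
  exact hm.hasDerivAt_eq_zero hd

theorem IsOptimal.mul_eq_mul_gram {m d : ℕ} {X : Matrix (Fin d) (Fin d) ℝ} (hX : Xᵀ = X)
    {w : Matrix (Fin m) (Fin d) ℝ} (hw : IsOptimal (gramLoss X) w) :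
    w * X = w * (wᵀ * w) := by
  set G := wᵀ * w with hG
  have hGs : Gᵀ = G := by simp [hG]
  -- Minus half the gradient at `w`: along it the loss has linear coefficient -2‖v‖_F², which must
  -- vanish.
  set v : Matrix (Fin m) (Fin d) ℝ := w * (X - G) with hv
  set H := wᵀ * v + vᵀ * w with hH
  set K := vᵀ * v with hK
  have expand : ∀ t : ℝ, (w + t • v)ᵀ * (w + t • v) = G + t • H + t ^ 2 • K := by
    intro t
    simp only [Matrix.transpose_add, Matrix.transpose_smul, Matrix.add_mul, Matrix.mul_add,
      Matrix.smul_mul, Matrix.mul_smul, hG, hH, hK, smul_add, smul_smul, pow_two]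
    abel
  have key : ∀ t : ℝ, 0 ≤ (-(X * H).trace + (G * H).trace) * t
      + (-(X * K).trace + (1 / 2) * (H * H).trace + (G * K).trace) * t ^ 2
      + (H * K).trace * t ^ 3 + ((1 / 2) * (K * K).trace) * t ^ 4 := by
    intro t
    have h := hw (w + t • v)
    unfold gramLoss at h
    rw [expand t] at h
    simp only [Matrix.add_mul, Matrix.mul_add, Matrix.smul_mul, Matrix.mul_smul,
      Matrix.trace_add, Matrix.trace_smul, smul_eq_mul, ← hG] at h
    rw [Matrix.trace_mul_comm H G, Matrix.trace_mul_comm K G, Matrix.trace_mul_comm K H] at h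
    linarith
  have h0 := linear_coeff_eq_zero_of_quartic_nonneg key
  have h1 : ((X - G) * H).trace = 2 * (v * vᵀ).trace := by
    have hvt : vᵀ = (X - G) * wᵀ := by
      rw [hv, Matrix.transpose_mul, Matrix.transpose_sub, hX, hGs]
    have e1 : ((X - G) * (wᵀ * v)).trace = (v * vᵀ).trace := by
      rw [hvt, ← Matrix.mul_assoc, Matrix.trace_mul_comm]
    have e2 : ((X - G) * (vᵀ * w)).trace = (v * vᵀ).trace := by
      rw [Matrix.trace_mul_comm, Matrix.mul_assoc, ← hv, Matrix.trace_mul_comm]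
    rw [hH, Matrix.mul_add, Matrix.trace_add, e1, e2]
    ring
  rw [Matrix.sub_mul, Matrix.trace_sub] at h1
  have h2 : (v * vᵀ).trace = 0 := by linarith
  have h3 : v = 0 := by
    have := (Matrix.trace_mul_conjTranspose_self_eq_zero_iff (A := v)).1
      (by simpa [Matrix.conjTranspose_eq_transpose_of_trivial] using h2)
    exact this
  rw [hv, Matrix.mul_sub, sub_eq_zero] at h3
  exact h3

theorem trace_mul_vecMulVec {d : ℕ} (M : Matrix (Fin d) (Fin d) ℝ) (x y : Fin d → ℝ) :
    (M * Matrix.vecMulVec x y).trace = y ⬝ᵥ M *ᵥ x := by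
  rw [Matrix.mul_vecMulVec, Matrix.trace_vecMulVec, dotProduct_comm]

theorem transpose_mulVec_dotProduct {m d : ℕ} (w : Matrix (Fin m) (Fin d) ℝ) (α : Fin m → ℝ)
    (z : Fin d → ℝ) : (wᵀ *ᵥ α) ⬝ᵥ z = α ⬝ᵥ w *ᵥ z := by
  rw [Matrix.dotProduct_mulVec, Matrix.mulVec_transpose]

/-- Exchanging an eigenvector of `w wᵀ` for an eigenvector of `X` in the kernel of `w`. -/
theorem IsOptimal.eigenvalue_le {m d : ℕ} {X : Matrix (Fin d) (Fin d) ℝ} (hX : Xᵀ = X)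
    {w : Matrix (Fin m) (Fin d) ℝ} (hw : IsOptimal (gramLoss X) w)
    {σ ρ : ℝ} (hσ : 0 ≤ σ) (hρ : 0 ≤ ρ) {α : Fin m → ℝ} (hα : α ⬝ᵥ α = 1)
    (hwα : (w * wᵀ) *ᵥ α = σ • α) {u : Fin d → ℝ} (hu : u ⬝ᵥ u = 1)
    (hwu : w *ᵥ u = 0) (hXu : X *ᵥ u = ρ • u) : ρ ≤ σ := by
  have hfoc := hw.mul_eq_mul_gram hX
  set b : Fin d → ℝ := wᵀ *ᵥ α with hb
  have hwb : w *ᵥ b = σ • α := by rw [hb, Matrix.mulVec_mulVec, hwα]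
  have hGb : (wᵀ * w) *ᵥ b = σ • b := by
    rw [← Matrix.mulVec_mulVec, hwb, Matrix.mulVec_smul]
  have hXb : X *ᵥ b = σ • b := by
    have : X * wᵀ = (wᵀ * w) * wᵀ := by
      have := congrArg Matrix.transpose hfoc
      simpa [hX, Matrix.mul_assoc] using this
    rw [hb, Matrix.mulVec_mulVec, this, ← Matrix.mulVec_mulVec, ← hb, hGb]
  have hbb : b ⬝ᵥ b = σ := by
    rw [show b ⬝ᵥ b = α ⬝ᵥ w *ᵥ b from transpose_mulVec_dotProduct w α b, hwb,
      dotProduct_smul, hα]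
    simp
  have hbu : b ⬝ᵥ u = 0 := by
    rw [hb, transpose_mulVec_dotProduct, hwu]; simp
  have hGu : (wᵀ * w) *ᵥ u = 0 := by rw [← Matrix.mulVec_mulVec, hwu]; simp
  -- The component of `w` in the direction `α` is replaced by √ρ u. In the Gram matrix bbᵀ becomes
  -- ρuuᵀ; since Xb = Gb = σb and |b|² = σ, the loss changes by (σ² - ρ²)/2.
  set v : Matrix (Fin m) (Fin d) ℝ :=
    w - Matrix.vecMulVec α b + √ρ • Matrix.vecMulVec α u with hv
  have hgram : vᵀ * v = wᵀ * w - Matrix.vecMulVec b b + ρ • Matrix.vecMulVec u u := by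
    have e1 : wᵀ * Matrix.vecMulVec α b = Matrix.vecMulVec b b := by
      rw [Matrix.mul_vecMulVec, ← hb]
    have e2 : wᵀ * Matrix.vecMulVec α u = Matrix.vecMulVec b u := by
      rw [Matrix.mul_vecMulVec, ← hb]
    have e3 : ∀ x : Fin d → ℝ, Matrix.vecMulVec x α * w = Matrix.vecMulVec x b := by
      intro x; rw [Matrix.vecMulVec_mul, hb, Matrix.mulVec_transpose]
    have e4 : ∀ x y : Fin d → ℝ,
        Matrix.vecMulVec x α * Matrix.vecMulVec α y = Matrix.vecMulVec x y := by
      intro x y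
      rw [Matrix.vecMulVec_mul_vecMulVec, hα]; simp
    simp only [hv, Matrix.transpose_add, Matrix.transpose_sub, Matrix.transpose_smul,
      Matrix.transpose_vecMulVec, Matrix.add_mul, Matrix.mul_add, Matrix.sub_mul, Matrix.mul_sub,
      Matrix.smul_mul, Matrix.mul_smul, e1, e2, e3, e4, smul_add, smul_sub,
      smul_smul, Real.mul_self_sqrt hρ]
    abel
  have h := hw v
  unfold gramLoss at h
  rw [hgram] at h
  simp only [Matrix.add_mul, Matrix.mul_add, Matrix.sub_mul, Matrix.mul_sub, Matrix.smul_mul,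
    Matrix.mul_smul, Matrix.trace_add, Matrix.trace_sub, Matrix.trace_smul, smul_eq_mul,
    trace_mul_vecMulVec] at h
  rw [Matrix.trace_mul_comm (Matrix.vecMulVec b b) (wᵀ * w),
    Matrix.trace_mul_comm (Matrix.vecMulVec u u) (wᵀ * w)] at h
  simp only [trace_mul_vecMulVec, hXb, hXu, hGb, hGu, Matrix.vecMulVec_mulVec, hbb, hbu, hu,
    dotProduct_comm u b, dotProduct_smul, dotProduct_zero, smul_eq_mul] at h
  simp at h
  nlinarith

theorem dotProduct_self_real_nonneg {d : ℕ} (v : Fin d → ℝ) : 0 ≤ v ⬝ᵥ v :=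
  Finset.sum_nonneg fun i _ => mul_self_nonneg (v i)

theorem dotProduct_sq_le {d : ℕ} (u v : Fin d → ℝ) : (u ⬝ᵥ v) ^ 2 ≤ (u ⬝ᵥ u) * (v ⬝ᵥ v) := by
  simpa [dotProduct, pow_two] using Finset.sum_mul_sq_le_sq_mul_sq Finset.univ u v

theorem eigenvectorBasis_dotProduct_self {d : ℕ} {M : Matrix (Fin d) (Fin d) ℝ}
    (hM : M.IsHermitian) (i : Fin d) :
    (hM.eigenvectorBasis i).ofLp ⬝ᵥ (hM.eigenvectorBasis i).ofLp = 1 := by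
  have h := hM.eigenvectorBasis.orthonormal.1 i
  have h2 : ‖hM.eigenvectorBasis i‖ ^ 2 = 1 := by rw [h]; norm_num
  rw [EuclideanSpace.real_norm_sq_eq] at h2
  simpa [dotProduct, pow_two] using h2

theorem quadForm_nonneg_of_eigen {d : ℕ} {M : Matrix (Fin d) (Fin d) ℝ} (hM : Mᵀ = M)
    (h : ∀ (u : Fin d → ℝ) (κ : ℝ), u ⬝ᵥ u = 1 → M *ᵥ u = κ • u → 0 ≤ κ) (v : Fin d → ℝ) :
    0 ≤ v ⬝ᵥ M *ᵥ v := by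
  have hH : M.IsHermitian := by
    rw [Matrix.IsHermitian, Matrix.conjTranspose_eq_transpose_of_trivial, hM]
  have hp : M.PosSemidef := hH.posSemidef_iff_eigenvalues_nonneg.2 fun i =>
    h _ _ (eigenvectorBasis_dotProduct_self hH i) (hH.mulVec_eigenvectorBasis i)
  simpa using hp.dotProduct_mulVec_nonneg v

theorem exists_min_eigenvector {m : ℕ} (hm : 0 < m) {M : Matrix (Fin m) (Fin m) ℝ} (hM : Mᵀ = M) :
    ∃ (σ : ℝ) (α : Fin m → ℝ), α ⬝ᵥ α = 1 ∧ M *ᵥ α = σ • α ∧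
      ∀ v : Fin m → ℝ, σ * (v ⬝ᵥ v) ≤ v ⬝ᵥ M *ᵥ v := by
  have hH : M.IsHermitian := by
    rw [Matrix.IsHermitian, Matrix.conjTranspose_eq_transpose_of_trivial, hM]
  have : Nonempty (Fin m) := ⟨⟨0, hm⟩⟩
  obtain ⟨i, hi⟩ := Finite.exists_min hH.eigenvalues
  refine ⟨hH.eigenvalues i, _, eigenvectorBasis_dotProduct_self hH i,
    hH.mulVec_eigenvectorBasis i, fun v => ?_⟩
  have hS : (M - hH.eigenvalues i • (1 : Matrix (Fin m) (Fin m) ℝ))ᵀ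
      = M - hH.eigenvalues i • (1 : Matrix (Fin m) (Fin m) ℝ) := by simp [hM]
  have := quadForm_nonneg_of_eigen hS (fun u κ hu hκ => ?_) v
  · rw [Matrix.sub_mulVec, dotProduct_sub, Matrix.smul_mulVec, Matrix.one_mulVec,
      dotProduct_smul, smul_eq_mul] at this
    linarith
  · have hMu : M *ᵥ u = (κ + hH.eigenvalues i) • u := by
      rw [Matrix.sub_mulVec, Matrix.smul_mulVec, Matrix.one_mulVec, sub_eq_iff_eq_add] at hκ
      rw [hκ, add_smul]
    have hu0 : u ≠ 0 := by
      rintro rfl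
      simp at hu
    have hev : Module.End.HasEigenvalue (Matrix.toLin' M) (κ + hH.eigenvalues i) :=
      Module.End.hasEigenvalue_of_hasEigenvector
        ⟨Module.End.mem_eigenspace_iff.2 (by simpa using hMu), hu0⟩
    have hsp : κ + hH.eigenvalues i ∈ spectrum ℝ M := by
      rw [← Matrix.spectrum_toLin']
      exact hev.mem_spectrum
    rw [hH.spectrum_real_eq_range_eigenvalues] at hsp
    obtain ⟨j, hj⟩ := hsp
    have := hi j
    linarith

/-- The residual `X - wᵀ w` at an optimum is bounded above by any bound for `X` on the vectors that
vanish on the first `n ≤ m` coordinates. -/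
theorem IsOptimal.residual_le {n m d : ℕ} (hnd : n ≤ d) (hnm : n ≤ m) (hm : 0 < m)
    {X : Matrix (Fin d) (Fin d) ℝ} (hX : Xᵀ = X)
    {w : Matrix (Fin m) (Fin d) ℝ} (hw : IsOptimal (gramLoss X) w) {η : ℝ} (hη : 0 ≤ η)
    (hXη : ∀ v : Fin d → ℝ, (∀ i : Fin n, v (Fin.castLE hnd i) = 0) →
      v ⬝ᵥ X *ᵥ v ≤ η * (v ⬝ᵥ v)) (v : Fin d → ℝ) :
    v ⬝ᵥ X *ᵥ v ≤ v ⬝ᵥ (wᵀ * w) *ᵥ v + η * (v ⬝ᵥ v) := by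
  have hfoc := hw.mul_eq_mul_gram hX
  have hfoc' : X * wᵀ = (wᵀ * w) * wᵀ := by
    have := congrArg Matrix.transpose hfoc
    simpa [hX, Matrix.mul_assoc] using this
  set R : Matrix (Fin d) (Fin d) ℝ := wᵀ * w + η • 1 - X with hR
  have hRs : Rᵀ = R := by simp [hR, hX]
  suffices h : 0 ≤ v ⬝ᵥ R *ᵥ v by
    rw [hR, Matrix.sub_mulVec, Matrix.add_mulVec, Matrix.smul_mulVec, Matrix.one_mulVec,
      dotProduct_sub, dotProduct_add, dotProduct_smul, smul_eq_mul] at h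
    linarith
  -- A negative eigenvalue κ of `R` is a direction missed by `w`: criticality forces wu = 0, so u is
  -- an eigenvector of `X` with eigenvalue ρ = η - κ > η.
  refine quadForm_nonneg_of_eigen hRs (fun u κ hu hκ => ?_) v
  by_contra hneg
  push Not at hneg
  set ρ := η - κ with hρ
  have hρη : η < ρ := by linarith
  have hρ0 : 0 < ρ := by linarith
  have hXG : X *ᵥ u = (wᵀ * w) *ᵥ u + ρ • u := by
    rw [hR, Matrix.sub_mulVec, Matrix.add_mulVec, Matrix.smul_mulVec, Matrix.one_mulVec] at hκ
    rw [hρ, sub_smul, ← hκ]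
    abel
  have hwu : w *ᵥ u = 0 := by
    have h1 : w *ᵥ (X *ᵥ u) = w *ᵥ ((wᵀ * w) *ᵥ u) := by
      rw [Matrix.mulVec_mulVec, Matrix.mulVec_mulVec, hfoc]
    rw [hXG, Matrix.mulVec_add, Matrix.mulVec_smul, add_eq_left, smul_eq_zero] at h1
    exact h1.resolve_left hρ0.ne'
  have hXu : X *ᵥ u = ρ • u := by
    rw [hXG, ← Matrix.mulVec_mulVec, hwu]; simp
  -- Exchanging the weakest direction of `w` for u gives ρ ≤ σ, so X is at least ρ on the range of
  -- wᵀ together with u.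
  obtain ⟨σ, α, hα, hwα, hmin⟩ := exists_min_eigenvector hm (M := w * wᵀ) (by simp)
  have hquad : ∀ z : Fin m → ℝ, z ⬝ᵥ (w * wᵀ) *ᵥ z = (wᵀ *ᵥ z) ⬝ᵥ (wᵀ *ᵥ z) := by
    intro z
    rw [transpose_mulVec_dotProduct, Matrix.mulVec_mulVec]
  have hσ : 0 ≤ σ := by
    have h1 := hquad α
    rw [hwα, dotProduct_smul, hα, smul_eq_mul, mul_one] at h1
    rw [h1]
    exact dotProduct_self_real_nonneg _
  have hρσ : ρ ≤ σ := hw.eigenvalue_le hX hσ hρ0.le hα hwα hu hwu hXu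
  -- There are m + 1 > n unknowns for n equations, so some nonzero (z, c) makes wᵀz + cu vanish on
  -- the first n coordinates. There X is at most η, against the lower bound ρ > η.
  let T : ((Fin m → ℝ) × ℝ) →ₗ[ℝ] (Fin n → ℝ) :=
    (LinearMap.funLeft ℝ ℝ (Fin.castLE hnd)) ∘ₗ
      ((Matrix.toLin' wᵀ).coprod (LinearMap.toSpanSingleton ℝ (Fin d → ℝ) u))
  have hker : LinearMap.ker T ≠ ⊥ := by
    apply LinearMap.ker_ne_bot_of_finrank_lt
    rw [Module.finrank_prod]
    simp
    omega
  obtain ⟨⟨z, c⟩, hz, hz0⟩ := Submodule.exists_mem_ne_zero_of_ne_bot hker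
  set y := wᵀ *ᵥ z with hy
  have hvan : ∀ i : Fin n, (y + c • u) (Fin.castLE hnd i) = 0 := by
    intro i
    have := congrFun (LinearMap.mem_ker.1 hz) i
    simpa [T, LinearMap.funLeft_apply] using this
  have hyu : y ⬝ᵥ u = 0 := by rw [hy, transpose_mulVec_dotProduct, hwu]; simp
  have hXy : X *ᵥ y = (wᵀ * w) *ᵥ y := by
    rw [hy, Matrix.mulVec_mulVec, hfoc', ← Matrix.mulVec_mulVec]
  have hXyu : u ⬝ᵥ X *ᵥ y = 0 := by
    rw [hXy, ← Matrix.mulVec_mulVec, dotProduct_comm, transpose_mulVec_dotProduct, hwu]; simp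
  have hle := hXη _ hvan
  have hyXy : y ⬝ᵥ X *ᵥ y = (w *ᵥ y) ⬝ᵥ (w *ᵥ y) := by
    rw [hXy, ← Matrix.mulVec_mulVec, dotProduct_comm, transpose_mulVec_dotProduct]
  have e1 : (y + c • u) ⬝ᵥ X *ᵥ (y + c • u) = (w *ᵥ y) ⬝ᵥ (w *ᵥ y) + c ^ 2 * ρ := by
    rw [Matrix.mulVec_add, Matrix.mulVec_smul, hXu, add_dotProduct, dotProduct_add, dotProduct_add,
      smul_dotProduct, smul_dotProduct, hXyu, hyXy]
    simp [hyu, hu]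
    ring
  have e2 : (y + c • u) ⬝ᵥ (y + c • u) = y ⬝ᵥ y + c ^ 2 := by
    simp [hyu, hu, dotProduct_comm u y]
    ring
  rw [e1, e2] at hle
  have hwy : w *ᵥ y = (w * wᵀ) *ᵥ z := by rw [hy, Matrix.mulVec_mulVec]
  have hcs := dotProduct_sq_le z (w *ᵥ y)
  have hmz := hmin z
  rw [hquad z, ← hy] at hmz
  have hzy : z ⬝ᵥ w *ᵥ y = y ⬝ᵥ y := by rw [hy, transpose_mulVec_dotProduct]
  rw [hzy] at hcs
  have hyy := dotProduct_self_real_nonneg y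
  have hzz := dotProduct_self_real_nonneg z
  have hww := dotProduct_self_real_nonneg (w *ᵥ y)
  have hpos : 0 < y ⬝ᵥ y + c ^ 2 := by
    rcases eq_or_ne z 0 with h | h
    · have hc : c ≠ 0 := by
        rintro rfl
        exact hz0 (by rw [h]; rfl)
      positivity
    · have h3 : 0 < z ⬝ᵥ z := lt_of_le_of_ne hzz fun h' => h (dotProduct_self_eq_zero.1 h'.symm)
      have : 0 < σ * (z ⬝ᵥ z) := mul_pos (by linarith) h3
      nlinarith [sq_nonneg c]
  -- Cauchy–Schwarz gives |y|⁴ = (z·wy)² ≤ |z|²|wy|², and σ|z|² ≤ |y|².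
  have hbig : σ * (y ⬝ᵥ y) ≤ (w *ᵥ y) ⬝ᵥ (w *ᵥ y) := by
    rcases hyy.eq_or_lt with h | h
    · rw [← h]; simpa using hww
    · refine le_of_mul_le_mul_left ?_ h
      calc (y ⬝ᵥ y) * (σ * (y ⬝ᵥ y)) = σ * (y ⬝ᵥ y) ^ 2 := by ring
        _ ≤ σ * ((z ⬝ᵥ z) * ((w *ᵥ y) ⬝ᵥ (w *ᵥ y))) := by gcongr
        _ = (σ * (z ⬝ᵥ z)) * ((w *ᵥ y) ⬝ᵥ (w *ᵥ y)) := by ring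
        _ ≤ _ := by gcongr
  have : ρ * (y ⬝ᵥ y + c ^ 2) ≤ η * (y ⬝ᵥ y + c ^ 2) := by
    calc ρ * (y ⬝ᵥ y + c ^ 2) = ρ * (y ⬝ᵥ y) + c ^ 2 * ρ := by ring
      _ ≤ σ * (y ⬝ᵥ y) + c ^ 2 * ρ := by gcongr
      _ ≤ _ := by linarith
  have := le_of_mul_le_mul_right this hpos
  linarith

theorem quadForm_single {d : ℕ} (M : Matrix (Fin d) (Fin d) ℝ) (i : Fin d) :
    (Pi.single i (1 : ℝ)) ⬝ᵥ M *ᵥ (Pi.single i (1 : ℝ)) = M i i := by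
  simp

theorem IsOptimal.diag_le {n m d : ℕ} (hnd : n ≤ d) (hnm : n ≤ m) (hm : 0 < m)
    {X : Matrix (Fin d) (Fin d) ℝ} (hX : Xᵀ = X)
    {w : Matrix (Fin m) (Fin d) ℝ} (hw : IsOptimal (gramLoss X) w) {η : ℝ} (hη : 0 ≤ η)
    (hXη : ∀ v : Fin d → ℝ, (∀ i : Fin n, v (Fin.castLE hnd i) = 0) →
      v ⬝ᵥ X *ᵥ v ≤ η * (v ⬝ᵥ v)) (i : Fin d) :
    X i i ≤ (wᵀ * w) i i + η := by
  have h := hw.residual_le hnd hnm hm hX hη hXη (Pi.single i 1)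
  rw [quadForm_single, quadForm_single] at h
  simpa using h

/-! ### Spectral norm estimates. -/

theorem specNorm_nonneg {d : ℕ} (M : Matrix (Fin d) (Fin d) ℝ) : 0 ≤ specNorm M := norm_nonneg _

theorem specNorm_add_le {d : ℕ} (M K : Matrix (Fin d) (Fin d) ℝ) :
    specNorm (M + K) ≤ specNorm M + specNorm K := by
  unfold specNorm; rw [map_add]; exact norm_add_le _ _

theorem specNorm_smul {d : ℕ} (c : ℝ) (M : Matrix (Fin d) (Fin d) ℝ) :
    specNorm (c • M) = |c| * specNorm M := by
  unfold specNorm; rw [map_smul, norm_smul, Real.norm_eq_abs]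

theorem specNorm_mul_le {d : ℕ} (M K : Matrix (Fin d) (Fin d) ℝ) :
    specNorm (M * K) ≤ specNorm M * specNorm K := by
  unfold specNorm; rw [map_mul]; exact norm_mul_le _ _

theorem specNorm_transpose {d : ℕ} (M : Matrix (Fin d) (Fin d) ℝ) :
    specNorm Mᵀ = specNorm M := by
  unfold specNorm
  rw [← Matrix.conjTranspose_eq_transpose_of_trivial, ← Matrix.star_eq_conjTranspose, map_star]
  exact norm_star (Matrix.toEuclideanCLM (n := Fin d) (𝕜 := ℝ) M)

theorem specNorm_transpose_mul_self {d : ℕ} (M : Matrix (Fin d) (Fin d) ℝ) :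
    specNorm (Mᵀ * M) = specNorm M * specNorm M := by
  unfold specNorm
  rw [← Matrix.conjTranspose_eq_transpose_of_trivial, ← Matrix.star_eq_conjTranspose, map_mul,
    map_star]
  exact CStarRing.norm_star_mul_self (x := Matrix.toEuclideanCLM (n := Fin d) (𝕜 := ℝ) M)

/-- Criticality gives G² = GX, hence ‖G‖² ≤ ‖G‖‖X‖. -/
theorem IsOptimal.specNorm_gram_le {m d : ℕ} {X : Matrix (Fin d) (Fin d) ℝ} (hX : Xᵀ = X)
    {w : Matrix (Fin m) (Fin d) ℝ} (hw : IsOptimal (gramLoss X) w) :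
    specNorm (wᵀ * w) ≤ specNorm X := by
  have hfoc := hw.mul_eq_mul_gram hX
  have h1 : (wᵀ * w)ᵀ * (wᵀ * w) = (wᵀ * w) * X := by
    rw [Matrix.mul_assoc wᵀ w X, hfoc]; simp [Matrix.mul_assoc]
  have h2 := specNorm_transpose_mul_self (wᵀ * w)
  rw [h1] at h2
  have h3 := specNorm_mul_le (wᵀ * w) X
  rw [h2] at h3
  rcases (specNorm_nonneg (wᵀ * w)).eq_or_lt with h | h
  · rw [← h]; exact specNorm_nonneg X
  · exact le_of_mul_le_mul_left h3 h

theorem specNorm_le_of_frobSq_le {d : ℕ} (M : Matrix (Fin d) (Fin d) ℝ) {δ : ℝ} (hδ : 0 ≤ δ)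
    (h : frobSq M ≤ δ ^ 2) : specNorm M ≤ δ := by
  refine ContinuousLinearMap.opNorm_le_bound _ hδ fun v => ?_
  refine le_of_sq_le_sq ?_ (by positivity)
  rw [mul_pow, EuclideanSpace.real_norm_sq_eq, EuclideanSpace.real_norm_sq_eq]
  calc ∑ i, (Matrix.toEuclideanCLM (n := Fin d) (𝕜 := ℝ) M v).ofLp i ^ 2
      = ∑ i, (∑ j, M i j * v.ofLp j) ^ 2 := by
        simp [Matrix.mulVec, dotProduct]
    _ ≤ ∑ i, (∑ j, M i j ^ 2) * (∑ j, v.ofLp j ^ 2) := by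
        gcongr with i _
        exact Finset.sum_mul_sq_le_sq_mul_sq _ _ _
    _ = frobSq M * ∑ j, v.ofLp j ^ 2 := by rw [← Finset.sum_mul]; rfl
    _ ≤ _ := by gcongr

theorem specNorm_diagonal_le {d : ℕ} (D : Fin d → ℝ) {L : ℝ} (hL : 0 ≤ L)
    (h : ∀ i, |D i| ≤ L) : specNorm (Matrix.diagonal D) ≤ L := by
  refine ContinuousLinearMap.opNorm_le_bound _ hL fun v => ?_
  refine le_of_sq_le_sq ?_ (by positivity)
  rw [mul_pow, EuclideanSpace.real_norm_sq_eq, EuclideanSpace.real_norm_sq_eq, Finset.mul_sum]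
  refine Finset.sum_le_sum fun i _ => ?_
  simp only [Matrix.ofLp_toEuclideanCLM, Matrix.mulVec_diagonal, mul_pow]
  refine mul_le_mul_of_nonneg_right ?_ (sq_nonneg _)
  exact sq_le_sq' (by linarith [(abs_le.1 (h i)).1]) (abs_le.1 (h i)).2

theorem quadForm_le_specNorm {d : ℕ} (M : Matrix (Fin d) (Fin d) ℝ) (v : Fin d → ℝ) :
    v ⬝ᵥ M *ᵥ v ≤ specNorm M * (v ⬝ᵥ v) := by
  have h1 := real_inner_le_norm (WithLp.toLp 2 v)
    (Matrix.toEuclideanCLM (n := Fin d) (𝕜 := ℝ) M (WithLp.toLp 2 v))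
  have h2 := (Matrix.toEuclideanCLM (n := Fin d) (𝕜 := ℝ) M).le_opNorm (WithLp.toLp 2 v)
  have h3 : ‖(WithLp.toLp 2 v : EuclideanSpace ℝ (Fin d))‖ ^ 2 = v ⬝ᵥ v := by
    rw [EuclideanSpace.real_norm_sq_eq]; simp [dotProduct, pow_two]
  have h4 : ⟪(WithLp.toLp 2 v : EuclideanSpace ℝ (Fin d)),
      Matrix.toEuclideanCLM (n := Fin d) (𝕜 := ℝ) M (WithLp.toLp 2 v)⟫_ℝ = v ⬝ᵥ M *ᵥ v := by
    rw [PiLp.inner_apply]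
    simp [dotProduct, mul_comm]
  rw [← h4, ← h3]
  refine h1.trans ?_
  calc _ ≤ ‖(WithLp.toLp 2 v : EuclideanSpace ℝ (Fin d))‖ * (specNorm M * ‖WithLp.toLp 2 v‖) := by
        gcongr; exact h2
    _ = _ := by ring

/-! ### Representability and perturbed Gram matrices. -/

theorem representability_le_one {m d : ℕ} (v : Matrix (Fin m) (Fin d) ℝ) (i : Fin d) :
    representability v i ≤ 1 := by
  unfold representability
  have h := Submodule.norm_starProjection_apply_le
    (Submodule.span ℝ (Set.range fun l : Fin m =>
      (WithLp.toLp 2 (v l) : EuclideanSpace ℝ (Fin d)))) (EuclideanSpace.single i (1 : ℝ))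
  rw [EuclideanSpace.single, PiLp.norm_single, norm_one] at h
  exact pow_le_one₀ (norm_nonneg _) h

/-- The projection y of e_i to the row space has the same inner products with the rows, so vy = ve_i
and (vᵀv)_ii = |vy|² ≤ ‖vᵀv‖|y|². -/
theorem gram_diag_le_representability {m d : ℕ} (v : Matrix (Fin m) (Fin d) ℝ) (i : Fin d) :
    (vᵀ * v) i i ≤ specNorm (vᵀ * v) * representability v i := by
  unfold representability
  set S := Submodule.span ℝ (Set.range fun l : Fin m =>
      (WithLp.toLp 2 (v l) : EuclideanSpace ℝ (Fin d))) with hS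
  set y := S.starProjection (EuclideanSpace.single i (1 : ℝ)) with hy
  have hrow : ∀ l, (v *ᵥ y.ofLp) l = v l i := by
    intro l
    have hmem : (WithLp.toLp 2 (v l) : EuclideanSpace ℝ (Fin d)) ∈ S :=
      Submodule.subset_span ⟨l, rfl⟩
    have h1 : ⟪(WithLp.toLp 2 (v l) : EuclideanSpace ℝ (Fin d)), y⟫_ℝ
        = ⟪(WithLp.toLp 2 (v l) : EuclideanSpace ℝ (Fin d)),
          EuclideanSpace.single i (1 : ℝ)⟫_ℝ := by
      rw [hy, ← Submodule.inner_starProjection_left_eq_right,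
        Submodule.starProjection_eq_self_iff.2 hmem]
    have h2 : ⟪(WithLp.toLp 2 (v l) : EuclideanSpace ℝ (Fin d)), y⟫_ℝ = (v *ᵥ y.ofLp) l := by
      rw [PiLp.inner_apply]; simp [Matrix.mulVec, dotProduct, mul_comm]
    rw [← h2, h1, EuclideanSpace.inner_single_right]; simp
  have h := quadForm_le_specNorm (vᵀ * v) y.ofLp
  have h3 : ‖y‖ ^ 2 = y.ofLp ⬝ᵥ y.ofLp := by
    rw [EuclideanSpace.real_norm_sq_eq]; simp [dotProduct, pow_two]
  rw [h3]
  refine le_trans (le_of_eq ?_) h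
  rw [← Matrix.mulVec_mulVec, dotProduct_comm, transpose_mulVec_dotProduct]
  simp [dotProduct, hrow, Matrix.mul_apply]

theorem gram_add_diag {m d : ℕ} (w ε : Matrix (Fin m) (Fin d) ℝ) (i : Fin d) :
    ((w + ε)ᵀ * (w + ε)) i i = (wᵀ * w) i i + diagPerturbation w ε i := by
  simp only [diagPerturbation, Matrix.mul_apply, Matrix.transpose_apply, Matrix.add_apply,
    Finset.mul_sum, ← Finset.sum_add_distrib]
  exact Finset.sum_congr rfl fun l _ => by ring

/-- The increment of the Gram matrix is the symmetric part of 2wᵀε + εᵀε, and taking the symmetric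
part does not increase the spectral norm. -/
theorem specNorm_gram_add_le {m d : ℕ} (w ε : Matrix (Fin m) (Fin d) ℝ) :
    specNorm ((w + ε)ᵀ * (w + ε)) ≤ specNorm (wᵀ * w) + normPerturbation w ε := by
  unfold normPerturbation
  set M := (2 : ℝ) • (wᵀ * ε) + εᵀ * ε with hM
  have h1 : (w + ε)ᵀ * (w + ε) = wᵀ * w + (1 / 2 : ℝ) • (M + Mᵀ) := by
    rw [hM]
    ext i j
    simp only [Matrix.transpose_add, Matrix.add_mul, Matrix.mul_add, Matrix.transpose_smul,
      Matrix.transpose_mul, Matrix.transpose_transpose, Matrix.add_apply, Matrix.smul_apply,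
      smul_eq_mul]
    ring
  rw [h1]
  refine (specNorm_add_le _ _).trans ?_
  rw [specNorm_smul]
  have h2 := specNorm_add_le M Mᵀ
  rw [specNorm_transpose] at h2
  rw [abs_of_pos (by norm_num : (0 : ℝ) < 1 / 2)]
  linarith

theorem div_le_representability {m d : ℕ} (w ε : Matrix (Fin m) (Fin d) ℝ) (i : Fin d) {p q : ℝ}
    (hq : 0 < q) (hp : p ≤ (wᵀ * w) i i) (hwq : specNorm (wᵀ * w) ≤ q) :
    (p + diagPerturbation w ε i) / (q + normPerturbation w ε) ≤ representability (w + ε) i := by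
  have hN : 0 ≤ normPerturbation w ε := specNorm_nonneg _
  rw [div_le_iff₀ (by linarith)]
  have hr : 0 ≤ representability (w + ε) i := sq_nonneg _
  have h1 := gram_diag_le_representability (w + ε) i
  rw [gram_add_diag] at h1
  have h2 := specNorm_gram_add_le w ε
  calc p + diagPerturbation w ε i ≤ _ := by linarith
    _ ≤ _ := h1
    _ ≤ (q + normPerturbation w ε) * representability (w + ε) i := by gcongr; linarith
    _ = _ := mul_comm _ _

/-! ### Concentration of empirical second moments. -/

/-- The empirical second moment matrix of a finite family of points. -/
def empMoment {ι : Type*} [Fintype ι] {d : ℕ} (x : ι → EuclideanSpace ℝ (Fin d)) :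
    Matrix (Fin d) (Fin d) ℝ :=
  Matrix.of fun i j => (1 / (Fintype.card ι : ℝ)) * ∑ s, x s i * x s j

theorem sum_coord_mul_sq {d : ℕ} (x : EuclideanSpace ℝ (Fin d)) :
    ∑ i, ∑ j, (x i * x j) ^ 2 = ‖x‖ ^ 4 := by
  have : ‖x‖ ^ 4 = (‖x‖ ^ 2) * (‖x‖ ^ 2) := by ring
  rw [this, EuclideanSpace.real_norm_sq_eq, Finset.sum_mul_sum]
  simp_rw [mul_pow]

theorem coord_mul_sq_le {d : ℕ} (x : EuclideanSpace ℝ (Fin d)) (i j : Fin d) :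
    (x i * x j) ^ 2 ≤ ‖x‖ ^ 4 := by
  rw [← sum_coord_mul_sq]
  refine le_trans ?_ (Finset.single_le_sum (f := fun i => ∑ j, (x i * x j) ^ 2)
    (fun i _ => Finset.sum_nonneg fun j _ => sq_nonneg _) (Finset.mem_univ i))
  exact Finset.single_le_sum (f := fun j => (x i * x j) ^ 2) (fun j _ => sq_nonneg _)
    (Finset.mem_univ j)

theorem memLp_coord_mul {Ω : Type*} [MeasurableSpace Ω] {P : Measure Ω} {d : ℕ}
    {x : Ω → EuclideanSpace ℝ (Fin d)} (hx : AEMeasurable x P)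
    (h4 : Integrable (fun ω => ‖x ω‖ ^ 4) P) (i j : Fin d) :
    MemLp (fun ω => x ω i * x ω j) 2 P := by
  have hm : AEMeasurable (fun ω => x ω i * x ω j) P := by fun_prop
  rw [memLp_two_iff_integrable_sq hm.aestronglyMeasurable]
  refine h4.mono' (by fun_prop) (Filter.Eventually.of_forall fun ω => ?_)
  rw [Real.norm_of_nonneg (sq_nonneg _)]
  exact coord_mul_sq_le _ i j

/-- Concentration of the empirical second moment matrix of independent vectors, in Frobenius
norm. -/
theorem measure_frobSq_empMoment_ge_le {ι : Type*} [Fintype ι] [Nonempty ι] {Ω : Type*}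
    [MeasurableSpace Ω] {P : Measure Ω} [IsProbabilityMeasure P] {d : ℕ}
    {x : ι → Ω → EuclideanSpace ℝ (Fin d)} (hx : ∀ s, AEMeasurable (x s) P)
    (hind : iIndepFun x P) {B : ℝ} (h4 : ∀ s, Integrable (fun ω => ‖x s ω‖ ^ 4) P)
    (hB : ∀ s, ∫ ω, ‖x s ω‖ ^ 4 ∂P ≤ B) {M : Matrix (Fin d) (Fin d) ℝ}
    (hM : ∀ i j, M i j = (1 / (Fintype.card ι : ℝ)) * ∑ s, ∫ ω, x s ω i * x s ω j ∂P)
    {δ : ℝ} (hδ : 0 < δ) :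
    P {ω | δ ≤ frobSq (empMoment (fun s => x s ω) - M)}
      ≤ ENNReal.ofReal (B / (Fintype.card ι * δ)) := by
  set c : ℝ := ((Fintype.card ι : ℕ) : ℝ) with hc
  have hc0 : 0 < c := by rw [hc]; exact_mod_cast Fintype.card_pos
  let Z : Fin d → Fin d → Ω → ℝ := fun i j => ∑ s, fun ω => x s ω i * x s ω j
  have hLp : ∀ s i j, MemLp (fun ω => x s ω i * x s ω j) 2 P := fun s i j =>
    memLp_coord_mul (hx s) (h4 s) i j
  have hZ : ∀ i j, MemLp (Z i j) 2 P := fun i j => memLp_finsetSum' _ fun s _ => hLp s i j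
  have hEZ : ∀ i j, ∫ ω, Z i j ω ∂P = c * M i j := by
    intro i j
    rw [hM, ← mul_assoc, mul_one_div_cancel hc0.ne', one_mul]
    simp only [Z, Finset.sum_apply]
    exact integral_finsetSum _ fun s _ => (hLp s i j).integrable (by norm_num)
  have hent : ∀ ω i j, (empMoment (fun s => x s ω) - M) i j
      = (1 / c) * (Z i j ω - ∫ ω, Z i j ω ∂P) := by
    intro ω i j
    rw [hEZ]
    simp only [empMoment, Matrix.sub_apply, Matrix.of_apply, Z, Finset.sum_apply, ← hc]
    field_simp
  have hfrob : ∀ ω, frobSq (empMoment (fun s => x s ω) - M)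
      = ∑ i, ∑ j, (1 / c) ^ 2 * (Z i j ω - ∫ ω, Z i j ω ∂P) ^ 2 := by
    intro ω
    unfold frobSq
    refine Finset.sum_congr rfl fun i _ => Finset.sum_congr rfl fun j _ => ?_
    rw [hent, mul_pow]
  have hZ_sq : ∀ i j, Integrable (fun ω => (1 / c) ^ 2 * (Z i j ω - ∫ ω, Z i j ω ∂P) ^ 2) P :=
    fun i j => (((hZ i j).sub (memLp_const _)).integrable_sq).const_mul _
  have hfrob_int : Integrable (fun ω => frobSq (empMoment (fun s => x s ω) - M)) P := by
    simp_rw [hfrob]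
    exact integrable_finsetSum _ fun i _ => integrable_finsetSum _ fun j _ => hZ_sq i j
  -- Variances of independent terms add, and each is at most a second moment. Summed over all
  -- entries these second moments give E‖x‖⁴.
  have hvar : ∀ i j, ∫ ω, (Z i j ω - ∫ ω, Z i j ω ∂P) ^ 2 ∂P
      ≤ ∑ s, ∫ ω, (x s ω i * x s ω j) ^ 2 ∂P := by
    intro i j
    rw [← variance_eq_integral (hZ i j).aemeasurable]
    have hf : Measurable fun v : EuclideanSpace ℝ (Fin d) => v i * v j := by fun_prop
    have hv : variance (Z i j) P = ∑ s, variance (fun ω => x s ω i * x s ω j) P := by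
      refine IndepFun.variance_sum (fun s _ => hLp s i j) fun s _ t _ hst => ?_
      exact (hind.indepFun hst).comp hf hf
    rw [hv]
    exact Finset.sum_le_sum fun s _ => variance_le_expectation_sq (hLp s i j).aestronglyMeasurable
  have hE : ∫ ω, frobSq (empMoment (fun s => x s ω) - M) ∂P ≤ B / c := by
    simp_rw [hfrob]
    rw [integral_finsetSum _ fun i _ => integrable_finsetSum _ fun j _ => hZ_sq i j]
    simp_rw [integral_finsetSum _ fun j _ => hZ_sq _ j, integral_const_mul]
    calc ∑ i, ∑ j, (1 / c) ^ 2 * ∫ ω, (Z i j ω - ∫ ω, Z i j ω ∂P) ^ 2 ∂P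
        ≤ ∑ i, ∑ j, (1 / c) ^ 2 * ∑ s, ∫ ω, (x s ω i * x s ω j) ^ 2 ∂P := by
          gcongr with i _ j _
          exact hvar i j
      _ = (1 / c) ^ 2 * ∑ s, ∑ i, ∑ j, ∫ ω, (x s ω i * x s ω j) ^ 2 ∂P := by
          simp_rw [← Finset.mul_sum]
          congr 1
          calc ∑ i, ∑ j, ∑ s, ∫ ω, (x s ω i * x s ω j) ^ 2 ∂P
              = ∑ i, ∑ s, ∑ j, ∫ ω, (x s ω i * x s ω j) ^ 2 ∂P :=
                Finset.sum_congr rfl fun i _ => Finset.sum_comm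
            _ = _ := Finset.sum_comm
      _ = (1 / c) ^ 2 * ∑ s, ∫ ω, ‖x s ω‖ ^ 4 ∂P := by
          congr 1
          refine Finset.sum_congr rfl fun s _ => ?_
          simp_rw [← sum_coord_mul_sq]
          rw [integral_finsetSum _ fun i _ => integrable_finsetSum _ fun j _ =>
            (hLp s i j).integrable_sq]
          refine Finset.sum_congr rfl fun i _ => ?_
          rw [integral_finsetSum _ fun j _ => (hLp s i j).integrable_sq]
      _ ≤ (1 / c) ^ 2 * ∑ _s : ι, B := by
          gcongr with s _
          exact hB s
      _ = B / c := by
          rw [Finset.sum_const, Finset.card_univ, nsmul_eq_mul, ← hc]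
          field_simp
  have hmk := mul_meas_ge_le_integral_of_nonneg
    (Filter.Eventually.of_forall fun ω => by
      simp only [Pi.zero_apply, frobSq]
      exact Finset.sum_nonneg fun i _ => Finset.sum_nonneg fun j _ => sq_nonneg _) hfrob_int δ
  have hfin : P.real {ω | δ ≤ frobSq (empMoment (fun s => x s ω) - M)} ≤ B / (c * δ) := by
    rw [← div_div, le_div_iff₀ hδ, mul_comm]
    exact hmk.trans hE
  rw [← ENNReal.ofReal_toReal (measure_ne_top P _)]
  exact ENNReal.ofReal_le_ofReal hfin

/-! ### Second and fourth moments of the class laws. -/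

instance : IsProbabilityMeasure signLaw := by
  constructor
  simp only [signLaw, Measure.coe_add, Measure.coe_smul, Pi.add_apply, Pi.smul_apply, measure_univ,
    smul_eq_mul, mul_one]
  rw [← ENNReal.ofReal_add (by norm_num) (by norm_num)]
  norm_num

theorem ae_abs_eq_one_signLaw : ∀ᵐ q ∂signLaw, |q| = 1 := by
  simp [signLaw, ae_add_measure_iff]

theorem integrable_signLaw (f : ℝ → ℝ) : Integrable f signLaw :=
  ((integrable_dirac (by simp)).smul_measure ENNReal.ofReal_ne_top).add_measure
    ((integrable_dirac (by simp)).smul_measure ENNReal.ofReal_ne_top)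

theorem integral_signLaw (f : ℝ → ℝ) : ∫ q, f q ∂signLaw = (f 1 + f (-1)) / 2 := by
  unfold signLaw
  rw [integral_add_measure ((integrable_dirac (by simp)).smul_measure ENNReal.ofReal_ne_top)
    ((integrable_dirac (by simp)).smul_measure ENNReal.ofReal_ne_top), integral_smul_measure,
    integral_smul_measure, integral_dirac, integral_dirac]
  simp
  ring

theorem memLp_two_signLaw : MemLp (fun q : ℝ => q) 2 signLaw :=
  (memLp_two_iff_integrable_sq (by fun_prop)).2 (integrable_signLaw _)

theorem memLp_two_gaussian : MemLp (fun q : ℝ => q) 2 (gaussianReal 0 1) :=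
  memLp_id_gaussianReal' 2 (by norm_num)

theorem integral_sq_gaussian : ∫ q, q ^ 2 ∂gaussianReal 0 1 = 1 := by
  have h := variance_id_gaussianReal (μ := 0) (v := 1)
  rw [variance_of_integral_eq_zero aemeasurable_id (by simp)] at h
  simpa using h

theorem integrable_pow_four_gaussian : Integrable (fun q : ℝ => q ^ 4) (gaussianReal 0 1) := by
  have h := (memLp_id_gaussianReal' (μ := 0) (v := 1) 4 (by norm_num)).integrable_norm_pow
    (by norm_num)
  refine h.congr (Filter.Eventually.of_forall fun q => ?_)
  simp only [id, Real.norm_eq_abs]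
  exact (by decide : Even 4).pow_abs q

section Product

variable {κ : Type*} [Fintype κ] {ν : Measure ℝ} [IsProbabilityMeasure ν]

theorem memLp_two_eval (h2 : MemLp (fun q : ℝ => q) 2 ν) (i : κ) :
    MemLp (fun q : κ → ℝ => q i) 2 (Measure.pi fun _ => ν) :=
  h2.comp_measurePreserving (measurePreserving_eval (fun _ : κ => ν) i)

theorem integral_eval_of_centered (h1 : ∫ q, q ∂ν = 0) (i : κ) :
    ∫ q : κ → ℝ, q i ∂(Measure.pi fun _ => ν) = 0 := by
  rw [integral_comp_eval (μ := fun _ : κ => ν) (f := fun q : ℝ => q) (by fun_prop), h1]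

theorem integral_eval_mul_eval [DecidableEq κ] (h1 : ∫ q, q ∂ν = 0)
    (hs : ∫ q, q ^ 2 ∂ν = 1) (i j : κ) :
    ∫ q : κ → ℝ, q i * q j ∂(Measure.pi fun _ => ν) = if i = j then 1 else 0 := by
  split_ifs with h
  · subst h
    simp_rw [← pow_two]
    rw [integral_comp_eval (μ := fun _ : κ => ν) (f := fun q : ℝ => q ^ 2) (by fun_prop), hs]
  · have hind : iIndepFun (fun (i : κ) (q : κ → ℝ) => q i) (Measure.pi fun _ : κ => ν) :=
      iIndepFun_pi (X := fun _ q => q) fun _ => by fun_prop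
    rw [(hind.indepFun h).integral_fun_mul_eq_mul_integral
      (measurable_pi_apply i).aestronglyMeasurable (measurable_pi_apply j).aestronglyMeasurable,
      integral_eval_of_centered h1, zero_mul]

end Product

/-- The noiseless part of a data point of class `c`, in coordinates. -/
def signal {n d : ℕ} (c : Fin (2 * n)) (q : Fin n → ℝ) (i : Fin d) : ℝ :=
  if hi : i.val < n then
    (if (⟨i.val, hi⟩ : Fin n) = classDir c then classSign c
      else -((d : ℝ) ^ (1 / 5 : ℝ) * q ⟨i.val, hi⟩))
  else 0

theorem classPoint_apply {n d : ℕ} (h : n ≤ d) (c : Fin (2 * n))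
    (p : (Fin n → ℝ) × (Fin d → ℝ)) (i : Fin d) :
    classPoint h c p i = signal c p.1 i + (d : ℝ) ^ (-(1 / 5) : ℝ) * p.2 i := by
  have hb : ∀ j : Fin n, basisVec h j i = if i.val = j.val then 1 else 0 := by
    intro j
    simp [basisVec, Fin.ext_iff]
  simp only [classPoint, PiLp.add_apply, PiLp.sub_apply, PiLp.smul_apply, smul_eq_mul, hb,
    WithLp.ofLp_sum, Finset.sum_apply, add_left_inj, signal, mul_ite, mul_one, mul_zero]
  by_cases hi : i.val < n
  · have e : ∀ j : Fin n, (i.val = j.val) ↔ (⟨i.val, hi⟩ : Fin n) = j := by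
      intro j; rw [Fin.ext_iff]
    simp only [e, hi, dite_true]
    simp only [Finset.sum_ite_eq, Finset.mem_erase, Finset.mem_univ, and_true]
    split_ifs <;> simp_all
  · have e : ∀ j : Fin n, i.val ≠ j.val := fun j hj => hi (hj ▸ j.2)
    simp [hi, e]

/-- The diagonal of the second moment matrix of a data point of class `c`. -/
def classDiag {n d : ℕ} (c : Fin (2 * n)) (i : Fin d) : ℝ :=
  (d : ℝ) ^ (-(2 / 5) : ℝ) + if hi : i.val < n then
    (if (⟨i.val, hi⟩ : Fin n) = classDir c then 1 else (d : ℝ) ^ (2 / 5 : ℝ)) else 0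

theorem classSign_mul_self {n : ℕ} (c : Fin (2 * n)) : classSign c * classSign c = 1 := by
  unfold classSign
  rw [← pow_add, ← two_mul, pow_mul]; simp

theorem abs_classSign {n : ℕ} (c : Fin (2 * n)) : |classSign c| = 1 := by
  simp [classSign]

theorem memLp_signal {n d : ℕ} (c : Fin (2 * n)) (i : Fin d) :
    MemLp (fun q : Fin n → ℝ => signal c q i) 2 (Measure.pi fun _ => signLaw) := by
  unfold signal
  split_ifs with hi h
  · exact memLp_const _
  · exact ((memLp_two_eval memLp_two_signLaw _).const_mul _).neg
  · exact memLp_const _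

theorem integral_signal_mul {n d : ℕ} (c : Fin (2 * n)) (i j : Fin d) :
    ∫ q : Fin n → ℝ, signal c q i * signal c q j ∂(Measure.pi fun _ => signLaw)
      = if i = j then (if hi : i.val < n then
          (if (⟨i.val, hi⟩ : Fin n) = classDir c then 1 else (d : ℝ) ^ (2 / 5 : ℝ)) else 0)
        else 0 := by
  have h1 : ∫ q, q ∂signLaw = 0 := by rw [integral_signLaw]; norm_num
  have h2 : ∫ q, q ^ 2 ∂signLaw = 1 := by rw [integral_signLaw]; norm_num
  have hτ : (d : ℝ) ^ (1 / 5 : ℝ) * (d : ℝ) ^ (1 / 5 : ℝ) = (d : ℝ) ^ (2 / 5 : ℝ) := by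
    rw [← pow_two, ← Real.rpow_natCast, ← Real.rpow_mul (Nat.cast_nonneg d)]
    norm_num
  by_cases hi : i.val < n
  swap
  · simp [signal, hi]
  by_cases hj : j.val < n
  swap
  · have hij : i ≠ j := fun h => hj (h ▸ hi)
    simp [signal, hj, hij]
  simp only [signal, hi, hj, dite_true]
  have hij : i = j ↔ (⟨i.val, hi⟩ : Fin n) = ⟨j.val, hj⟩ := by simp [Fin.ext_iff]
  rw [if_congr hij rfl rfl]
  generalize (⟨i.val, hi⟩ : Fin n) = i'
  generalize (⟨j.val, hj⟩ : Fin n) = j'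
  by_cases hi' : i' = classDir c <;> by_cases hj' : j' = classDir c
  · simp [hi', hj', classSign_mul_self]
  · have : ¬ i' = j' := fun h => hj' (h ▸ hi')
    simp only [hi', hj', if_true, if_false, mul_neg]
    rw [integral_neg, integral_const_mul, integral_const_mul, integral_eval_of_centered h1,
      if_neg (fun h => hj' h.symm)]
    simp
  · have : ¬ i' = j' := fun h => hi' (h.trans hj')
    simp only [hi', hj', if_true, if_false, neg_mul]
    rw [integral_neg, integral_mul_const, integral_const_mul, integral_eval_of_centered h1]
    simp
  · simp only [hi', hj', if_false, neg_mul_neg]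
    have : ∀ q : Fin n → ℝ, (d : ℝ) ^ (1 / 5 : ℝ) * q i' * ((d : ℝ) ^ (1 / 5 : ℝ) * q j')
        = (d : ℝ) ^ (2 / 5 : ℝ) * (q i' * q j') := by
      intro q; rw [← hτ]; ring
    simp_rw [this]
    rw [integral_const_mul, integral_eval_mul_eval h1 h2]
    simp

theorem measurable_classPoint {n d : ℕ} (h : n ≤ d) (c : Fin (2 * n)) :
    Measurable (classPoint h c) := by
  unfold classPoint
  fun_prop

instance {n d : ℕ} (h : n ≤ d) (c : Fin (2 * n)) : IsProbabilityMeasure (classLaw h c) :=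
  Measure.isProbabilityMeasure_map (measurable_classPoint h c).aemeasurable

/-- The class mean ±e_i has one nonzero coordinate, and the remaining randomness is centred and
uncorrelated, so no off-diagonal moment survives. -/
theorem integral_coord_mul_classLaw {n d : ℕ} (h : n ≤ d) (c : Fin (2 * n)) (i j : Fin d) :
    ∫ x, x i * x j ∂classLaw h c = Matrix.diagonal (classDiag c) i j := by
  unfold classLaw
  rw [integral_map (measurable_classPoint h c).aemeasurable (by fun_prop)]
  simp_rw [classPoint_apply]
  set μ := (d : ℝ) ^ (-(1 / 5) : ℝ) with hμ
  have hμ2 : μ * μ = (d : ℝ) ^ (-(2 / 5) : ℝ) := by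
    rw [hμ, ← pow_two, ← Real.rpow_natCast, ← Real.rpow_mul (Nat.cast_nonneg d)]
    norm_num
  set Q := Measure.pi fun _ : Fin n => signLaw with hQ
  set Γ := Measure.pi fun _ : Fin d => gaussianReal 0 1 with hΓ
  have hg1 : ∫ q, q ∂gaussianReal 0 1 = 0 := by simp
  have mS : ∀ i : Fin d, MemLp (fun q : Fin n → ℝ => signal c q i) 2 Q := memLp_signal c
  have mG : ∀ i, MemLp (fun ξ : Fin d → ℝ => ξ i) 2 Γ := memLp_two_eval memLp_two_gaussian
  have iS : ∀ i : Fin d, Integrable (fun q : Fin n → ℝ => signal c q i) Q := fun i =>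
    (mS i).integrable (by norm_num)
  have iG : ∀ i, Integrable (fun ξ : Fin d → ℝ => ξ i) Γ := fun i =>
    (mG i).integrable (by norm_num)
  have i1 : Integrable (fun p : (Fin n → ℝ) × (Fin d → ℝ) => signal c p.1 i * signal c p.1 j)
      (Q.prod Γ) := ((mS i).integrable_mul (mS j)).comp_fst Γ
  have i2 : Integrable (fun p : (Fin n → ℝ) × (Fin d → ℝ) => μ * (signal c p.1 i * p.2 j))
      (Q.prod Γ) := ((iS i).mul_prod (iG j)).const_mul μ
  have i3 : Integrable (fun p : (Fin n → ℝ) × (Fin d → ℝ) => μ * (signal c p.1 j * p.2 i))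
      (Q.prod Γ) := ((iS j).mul_prod (iG i)).const_mul μ
  have i4 : Integrable (fun p : (Fin n → ℝ) × (Fin d → ℝ) => μ * μ * (p.2 i * p.2 j))
      (Q.prod Γ) := (((mG i).integrable_mul (mG j)).comp_snd Q).const_mul _
  have e : ∀ p : (Fin n → ℝ) × (Fin d → ℝ),
      (signal c p.1 i + μ * p.2 i) * (signal c p.1 j + μ * p.2 j)
      = signal c p.1 i * signal c p.1 j + μ * (signal c p.1 i * p.2 j)
        + μ * (signal c p.1 j * p.2 i) + μ * μ * (p.2 i * p.2 j) := fun p => by ring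
  simp_rw [e]
  rw [integral_add ((i1.fun_add i2).fun_add i3) i4, integral_add (i1.fun_add i2) i3,
    integral_add i1 i2,
    integral_const_mul, integral_const_mul, integral_const_mul,
    integral_prod_mul (fun q : Fin n → ℝ => signal c q i) (fun ξ : Fin d → ℝ => ξ j),
    integral_prod_mul (fun q : Fin n → ℝ => signal c q j) (fun ξ : Fin d → ℝ => ξ i),
    integral_fun_fst (fun q : Fin n → ℝ => signal c q i * signal c q j),
    integral_fun_snd (fun ξ : Fin d → ℝ => ξ i * ξ j),
    integral_eval_of_centered hg1, integral_eval_of_centered hg1,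
    integral_eval_mul_eval hg1 integral_sq_gaussian, integral_signal_mul, hμ2,
    Matrix.diagonal_apply]
  by_cases hij : i = j
  · simp only [hij, if_true, classDiag, probReal_univ, smul_eq_mul]
    ring
  · simp [hij]

/-- The fourth moment of a standard Gaussian variable. -/
def gaussianFourthMoment : ℝ := ∫ q, q ^ 4 ∂gaussianReal 0 1

theorem norm_basisVec {n d : ℕ} (h : n ≤ d) (i : Fin n) : ‖basisVec h i‖ = 1 := by
  rw [basisVec, EuclideanSpace.single, PiLp.norm_single, norm_one]

/-- The feature has norm 1 ≤ τ and there are n - 1 nuisance terms of norm τ, whence nτ. -/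
theorem norm_classPoint_le {n d : ℕ} (h : n ≤ d) (hd : 0 < d) (c : Fin (2 * n))
    (p : (Fin n → ℝ) × (Fin d → ℝ)) (hp : ∀ j, |p.1 j| = 1) :
    ‖classPoint h c p‖ ≤ n * (d : ℝ) ^ (1 / 5 : ℝ)
      + (d : ℝ) ^ (-(1 / 5) : ℝ) * ‖(WithLp.toLp 2 p.2 : EuclideanSpace ℝ (Fin d))‖ := by
  have hτ : (1 : ℝ) ≤ (d : ℝ) ^ (1 / 5 : ℝ) :=
    Real.one_le_rpow (by exact_mod_cast hd) (by norm_num)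
  have hμ : (0 : ℝ) ≤ (d : ℝ) ^ (-(1 / 5) : ℝ) := by positivity
  unfold classPoint
  refine (norm_add_le _ _).trans (add_le_add ((norm_sub_le _ _).trans ?_) ?_)
  · rw [norm_smul, norm_basisVec, Real.norm_eq_abs, abs_classSign]
    have h1 : ‖∑ j ∈ Finset.univ.erase (classDir c),
        ((d : ℝ) ^ (1 / 5 : ℝ) * p.1 j) • basisVec h j‖ ≤ (n - 1) * (d : ℝ) ^ (1 / 5 : ℝ) := by
      refine (norm_sum_le _ _).trans ?_
      have : ∀ j, ‖((d : ℝ) ^ (1 / 5 : ℝ) * p.1 j) • basisVec h j‖ = (d : ℝ) ^ (1 / 5 : ℝ) := by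
        intro j
        rw [norm_smul, norm_basisVec, Real.norm_eq_abs, abs_mul, hp,
          abs_of_pos (by linarith)]
        ring
      simp_rw [this]
      have hn : 1 ≤ n := (Nat.zero_le _).trans_lt (classDir c).2
      rw [Finset.sum_const, Finset.card_erase_of_mem (Finset.mem_univ _), Finset.card_univ,
        Fintype.card_fin, nsmul_eq_mul, Nat.cast_sub hn, Nat.cast_one]
    linarith
  · rw [norm_smul, Real.norm_of_nonneg hμ]

theorem norm_pow_four_classPoint_le {n d : ℕ} (h : n ≤ d) (hd : 0 < d) (c : Fin (2 * n))
    (p : (Fin n → ℝ) × (Fin d → ℝ)) (hp : ∀ j, |p.1 j| = 1) :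
    ‖classPoint h c p‖ ^ 4 ≤ 8 * ((n * (d : ℝ) ^ (1 / 5 : ℝ)) ^ 4
      + ((d : ℝ) ^ (-(1 / 5) : ℝ)) ^ 4 * (d * ∑ i, p.2 i ^ 4)) := by
  have h1 : ‖(WithLp.toLp 2 p.2 : EuclideanSpace ℝ (Fin d))‖ ^ 4 ≤ d * ∑ i, p.2 i ^ 4 := by
    have : ‖(WithLp.toLp 2 p.2 : EuclideanSpace ℝ (Fin d))‖ ^ 4
        = (‖(WithLp.toLp 2 p.2 : EuclideanSpace ℝ (Fin d))‖ ^ 2) ^ 2 := by ring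
    rw [this, EuclideanSpace.real_norm_sq_eq]
    have h2 := sq_sum_le_card_mul_sum_sq (s := Finset.univ) (f := fun i : Fin d => p.2 i ^ 2)
    simpa [← pow_mul] using h2
  calc ‖classPoint h c p‖ ^ 4 ≤ _ :=
        pow_le_pow_left₀ (norm_nonneg _) (norm_classPoint_le h hd c p hp) 4
    _ ≤ 2 ^ (4 - 1) * ((n * (d : ℝ) ^ (1 / 5 : ℝ)) ^ 4
      + ((d : ℝ) ^ (-(1 / 5) : ℝ) * ‖(WithLp.toLp 2 p.2 : EuclideanSpace ℝ (Fin d))‖) ^ 4) :=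
        add_pow_le (by positivity) (by positivity) 4
    _ ≤ _ := by
        rw [mul_pow ((d : ℝ) ^ (-(1 / 5) : ℝ))]
        norm_num
        gcongr

theorem fourthMoment_classLaw {n d : ℕ} (h : n ≤ d) (hd : 0 < d) (c : Fin (2 * n)) :
    Integrable (fun x => ‖x‖ ^ 4) (classLaw h c) ∧
    ∫ x, ‖x‖ ^ 4 ∂classLaw h c ≤ 8 * ((n * (d : ℝ) ^ (1 / 5 : ℝ)) ^ 4
      + ((d : ℝ) ^ (-(1 / 5) : ℝ)) ^ 4 * (d * (d * gaussianFourthMoment))) := by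
  unfold classLaw
  rw [integrable_map_measure (by fun_prop) (measurable_classPoint h c).aemeasurable,
    integral_map (measurable_classPoint h c).aemeasurable (by fun_prop)]
  set Q := Measure.pi fun _ : Fin n => signLaw with hQ
  set Γ := Measure.pi fun _ : Fin d => gaussianReal 0 1 with hΓ
  have hae : ∀ᵐ p ∂(Q.prod Γ), ∀ j, |p.1 j| = 1 := by
    have h1 : ∀ᵐ q ∂Q, ∀ j, |q j| = 1 := ae_all_iff.2 fun j =>
      (Measure.tendsto_eval_ae_ae (μ := fun _ : Fin n => signLaw) (i := j)).eventually
        ae_abs_eq_one_signLaw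
    exact Measure.quasiMeasurePreserving_fst.ae h1
  have i4 : ∀ i, Integrable (fun ξ : Fin d → ℝ => ξ i ^ 4) Γ := fun i =>
    integrable_comp_eval (μ := fun _ : Fin d => gaussianReal 0 1) (f := fun q : ℝ => q ^ 4)
      integrable_pow_four_gaussian
  have is : Integrable (fun ξ : Fin d → ℝ => ∑ i, ξ i ^ 4) Γ :=
    integrable_finsetSum _ fun i _ => i4 i
  have ib : Integrable (fun p : (Fin n → ℝ) × (Fin d → ℝ) => 8 * ((n * (d : ℝ) ^ (1 / 5 : ℝ)) ^ 4
      + ((d : ℝ) ^ (-(1 / 5) : ℝ)) ^ 4 * (d * ∑ i, p.2 i ^ 4))) (Q.prod Γ) :=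
    ((integrable_const _).add (((is.comp_snd Q).const_mul _).const_mul _)).const_mul _
  have hle : ∀ᵐ p ∂(Q.prod Γ), ‖classPoint h c p‖ ^ 4 ≤ 8 * ((n * (d : ℝ) ^ (1 / 5 : ℝ)) ^ 4
      + ((d : ℝ) ^ (-(1 / 5) : ℝ)) ^ 4 * (d * ∑ i, p.2 i ^ 4)) := by
    filter_upwards [hae] with p hp using norm_pow_four_classPoint_le h hd c p hp
  have hi : Integrable (fun p => ‖classPoint h c p‖ ^ 4) (Q.prod Γ) := by
    refine ib.mono' ?_ ?_
    · exact ((measurable_classPoint h c).norm.pow_const 4).aestronglyMeasurable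
    · filter_upwards [hle] with p hp
      rwa [Real.norm_of_nonneg (by positivity)]
  refine ⟨hi, (integral_mono_ae hi ib hle).trans (le_of_eq ?_)⟩
  rw [integral_const_mul, integral_add (integrable_const _)
    (((is.comp_snd Q).const_mul _).const_mul _), integral_const_mul, integral_const_mul,
    integral_fun_snd (fun ξ : Fin d → ℝ => ∑ i, ξ i ^ 4), integral_finsetSum _ fun i _ => i4 i]
  have : ∀ i : Fin d, ∫ ξ : Fin d → ℝ, ξ i ^ 4 ∂Γ = gaussianFourthMoment := fun i =>
    integral_comp_eval (μ := fun _ : Fin d => gaussianReal 0 1) (f := fun q : ℝ => q ^ 4)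
      (by fun_prop)
  simp [this]

/-! ### Deviation probability for samples of the classes. -/

/-- The diagonal of the expected second moment matrix of samples with labels `y`. -/
def avgDiag {ι : Type*} [Fintype ι] {n d : ℕ} (y : ι → Fin (2 * n)) (i : Fin d) : ℝ :=
  (1 / (Fintype.card ι : ℝ)) * ∑ s, classDiag (y s) i

theorem gaussianFourthMoment_nonneg : 0 ≤ gaussianFourthMoment :=
  integral_nonneg fun q => by positivity

/-- The Gaussian part μ⁴d² = d^{6/5} dominates the fourth moment, since the signal gives only n⁴τ⁴ =
O(d). With N ≥ d^{2+γ} and threshold μ⁴ = d^{-4/5}, the exponents in Markov's bound add up to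
exactly -γ. -/
theorem measure_frobSq_classSample_ge_le {ι : Type*} [Fintype ι] {Ω : Type*} [MeasurableSpace Ω]
    {P : Measure Ω} [IsProbabilityMeasure P] {n d : ℕ} (hnd : n ≤ d) (hd : 0 < d) {c₂ γ : ℝ}
    (hn : (n : ℝ) ≤ c₂ * (d : ℝ) ^ (1 / 20 : ℝ)) (hN : (d : ℝ) ^ (2 + γ) ≤ Fintype.card ι)
    (y : ι → Fin (2 * n)) {x : ι → Ω → EuclideanSpace ℝ (Fin d)}
    (hx : ∀ s, HasLaw (x s) (classLaw hnd (y s)) P) (hind : iIndepFun x P) :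
    P {ω | ((d : ℝ) ^ (-(2 / 5) : ℝ)) ^ 2
        ≤ frobSq (empMoment (fun s => x s ω) - Matrix.diagonal (avgDiag y))}
      ≤ ENNReal.ofReal (8 * (c₂ ^ 4 + gaussianFourthMoment) * (d : ℝ) ^ (-γ)) := by
  have hd0 : (0 : ℝ) < d := by exact_mod_cast hd
  have hd1 : (1 : ℝ) ≤ d := by exact_mod_cast hd
  have hcard : (0 : ℝ) < Fintype.card ι := lt_of_lt_of_le (by positivity) hN
  have : Nonempty ι := Fintype.card_pos_iff.1 (by exact_mod_cast hcard)
  set B : ℝ := 8 * ((n * (d : ℝ) ^ (1 / 5 : ℝ)) ^ 4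
      + ((d : ℝ) ^ (-(1 / 5) : ℝ)) ^ 4 * (d * (d * gaussianFourthMoment))) with hB
  have hδ : 0 < ((d : ℝ) ^ (-(2 / 5) : ℝ)) ^ 2 := by positivity
  refine (measure_frobSq_empMoment_ge_le (B := B) (fun s => (hx s).aemeasurable) hind
    (fun s => ?_) (fun s => ?_) (fun i j => ?_) hδ).trans (ENNReal.ofReal_le_ofReal ?_)
  · have h := (fourthMoment_classLaw hnd hd (y s)).1
    rw [← (hx s).map_eq] at h
    exact h.comp_aemeasurable (hx s).aemeasurable
  · have h := (hx s).integral_comp (f := fun v => ‖v‖ ^ 4) (by fun_prop)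
    exact h.trans_le (fourthMoment_classLaw hnd hd (y s)).2
  · have h : ∀ s, ∫ ω, x s ω i * x s ω j ∂P = Matrix.diagonal (classDiag (y s)) i j := by
      intro s
      rw [← integral_coord_mul_classLaw hnd (y s) i j]
      exact (hx s).integral_comp (f := fun v => v i * v j) (by fun_prop)
    simp_rw [h, Matrix.diagonal_apply]
    split_ifs <;> simp [avgDiag]
  · have e1 : (n * (d : ℝ) ^ (1 / 5 : ℝ)) ^ 4 ≤ c₂ ^ 4 * (d : ℝ) ^ (6 / 5 : ℝ) := by
      calc (n * (d : ℝ) ^ (1 / 5 : ℝ)) ^ 4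
          ≤ (c₂ * (d : ℝ) ^ (1 / 20 : ℝ) * (d : ℝ) ^ (1 / 5 : ℝ)) ^ 4 := by gcongr
        _ = c₂ ^ 4 * (d : ℝ) ^ (1 : ℝ) := by
          rw [mul_assoc, ← Real.rpow_add hd0, mul_pow,
            ← Real.rpow_natCast ((d : ℝ) ^ (1 / 20 + 1 / 5 : ℝ)) 4, ← Real.rpow_mul hd0.le]
          norm_num
        _ ≤ _ := by
          refine mul_le_mul_of_nonneg_left ?_ (by positivity)
          exact Real.rpow_le_rpow_of_exponent_le hd1 (by norm_num)
    have e2 : ((d : ℝ) ^ (-(1 / 5) : ℝ)) ^ 4 * (d * (d * gaussianFourthMoment))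
        = gaussianFourthMoment * (d : ℝ) ^ (6 / 5 : ℝ) := by
      have : (d : ℝ) ^ (6 / 5 : ℝ) = ((d : ℝ) ^ (-(1 / 5) : ℝ)) ^ 4 * (d * d) := by
        rw [← pow_two (d : ℝ), ← Real.rpow_natCast _ 4, ← Real.rpow_natCast _ 2,
          ← Real.rpow_mul hd0.le, ← Real.rpow_add hd0]
        norm_num
      rw [this]; ring
    have hBle : B ≤ 8 * (c₂ ^ 4 + gaussianFourthMoment) * (d : ℝ) ^ (6 / 5 : ℝ) := by
      rw [hB, e2]; linarith
    rw [div_le_iff₀ (by positivity)]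
    refine hBle.trans ?_
    have hK := gaussianFourthMoment_nonneg
    have e3 : (d : ℝ) ^ (6 / 5 : ℝ)
        = (d : ℝ) ^ (-γ) * ((d : ℝ) ^ (2 + γ) * ((d : ℝ) ^ (-(2 / 5) : ℝ)) ^ 2) := by
      rw [← Real.rpow_natCast _ 2, ← Real.rpow_mul hd0.le, ← Real.rpow_add hd0,
        ← Real.rpow_add hd0]
      congr 1
      push_cast
      ring
    rw [e3, ← mul_assoc]
    gcongr

/-! ### Reduction of the objectives to `gramLoss`. -/

theorem empMoment_transpose {ι : Type*} [Fintype ι] {d : ℕ} (x : ι → EuclideanSpace ℝ (Fin d)) :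
    (empMoment x)ᵀ = empMoment x := by
  ext i j
  simp [empMoment, mul_comm]

theorem trace_mul_gram {m d : ℕ} (X : Matrix (Fin d) (Fin d) ℝ) (w : Matrix (Fin m) (Fin d) ℝ) :
    (X * (wᵀ * w)).trace = ∑ i, ∑ j, X i j * (wᵀ * w) j i := by
  simp [Matrix.trace, Matrix.mul_apply]

theorem inner_toEuclideanLin_self {m d : ℕ} (w : Matrix (Fin m) (Fin d) ℝ)
    (x : EuclideanSpace ℝ (Fin d)) :
    ⟪Matrix.toEuclideanLin w x, Matrix.toEuclideanLin w x⟫_ℝ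
      = ∑ i, ∑ j, x i * x j * (wᵀ * w) j i := by
  have h : ∀ l, (Matrix.toEuclideanLin w x) l = ∑ i, w l i * x i := fun l => rfl
  rw [PiLp.inner_apply]
  simp only [h, RCLike.inner_apply, conj_trivial, Matrix.mul_apply, Matrix.transpose_apply]
  calc ∑ l, (∑ i, w l i * x i) * ∑ i, w l i * x i
      = ∑ l, ∑ i, ∑ j, x i * x j * (w l j * w l i) := by
        refine Finset.sum_congr rfl fun l _ => ?_
        rw [Finset.sum_mul_sum]
        exact Finset.sum_congr rfl fun i _ => Finset.sum_congr rfl fun j _ => by ring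
    _ = ∑ i, ∑ l, ∑ j, x i * x j * (w l j * w l i) := Finset.sum_comm
    _ = ∑ i, ∑ j, ∑ l, x i * x j * (w l j * w l i) :=
        Finset.sum_congr rfl fun i _ => Finset.sum_comm
    _ = _ := by simp_rw [Finset.mul_sum]

theorem mean_inner_toEuclideanLin {ι : Type*} [Fintype ι] {m d : ℕ}
    (x : ι → EuclideanSpace ℝ (Fin d)) (w : Matrix (Fin m) (Fin d) ℝ) :
    (1 / (Fintype.card ι : ℝ)) *
        ∑ s, ⟪Matrix.toEuclideanLin w (x s), Matrix.toEuclideanLin w (x s)⟫_ℝ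
      = (empMoment x * (wᵀ * w)).trace := by
  rw [trace_mul_gram]
  simp_rw [inner_toEuclideanLin_self, empMoment, Matrix.of_apply]
  rw [Finset.sum_comm, Finset.mul_sum]
  refine Finset.sum_congr rfl fun i _ => ?_
  rw [Finset.sum_comm, Finset.mul_sum]
  refine Finset.sum_congr rfl fun j _ => ?_
  rw [← Finset.sum_mul, mul_assoc]

theorem frobSq_gram {m d : ℕ} (w : Matrix (Fin m) (Fin d) ℝ) :
    frobSq (wᵀ * w) = ((wᵀ * w) * (wᵀ * w)).trace := by
  have h : ∀ i j, (wᵀ * w) j i = (wᵀ * w) i j := fun i j => by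
    simp only [Matrix.mul_apply, Matrix.transpose_apply, mul_comm]
  rw [trace_mul_gram]
  simp only [frobSq, pow_two]
  exact Finset.sum_congr rfl fun i _ => Finset.sum_congr rfl fun j _ => by rw [h i j]

theorem gramLoss_eq {m d : ℕ} (X : Matrix (Fin d) (Fin d) ℝ) (w : Matrix (Fin m) (Fin d) ℝ) :
    gramLoss X w = -(X * (wᵀ * w)).trace + (1 / 2) * frobSq (wᵀ * w) := by
  rw [frobSq_gram, gramLoss]

/-- The zero means kill both cross terms. The correlation of the two noises remains, but it does not
depend on `v`. -/
theorem IsCenteredNoise.integral_inner {m : ℕ}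
    {π : Measure (EuclideanSpace ℝ (Fin m) × EuclideanSpace ℝ (Fin m))} (hπ : IsCenteredNoise π)
    (v : EuclideanSpace ℝ (Fin m)) :
    ∫ p, ⟪v + p.1, v + p.2⟫_ℝ ∂π = ⟪v, v⟫_ℝ + ∫ p, ⟪p.1, p.2⟫_ℝ ∂π := by
  have := hπ.prob
  have i1 : Integrable (fun p : EuclideanSpace ℝ (Fin m) × EuclideanSpace ℝ (Fin m) =>
      ⟪v, p.1⟫_ℝ) π := hπ.integrable_fst.const_inner v
  have i2 : Integrable (fun p : EuclideanSpace ℝ (Fin m) × EuclideanSpace ℝ (Fin m) =>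
      ⟪v, p.2⟫_ℝ) π := hπ.integrable_snd.const_inner v
  have e : ∀ p : EuclideanSpace ℝ (Fin m) × EuclideanSpace ℝ (Fin m),
      ⟪v + p.1, v + p.2⟫_ℝ = ⟪v, v⟫_ℝ + ⟪v, p.2⟫_ℝ + ⟪v, p.1⟫_ℝ + ⟪p.1, p.2⟫_ℝ := by
    intro p
    rw [inner_add_left, inner_add_right, inner_add_right, real_inner_comm v p.1]
    ring
  simp_rw [e]
  rw [integral_add (((integrable_const _).fun_add i2).fun_add i1) hπ.integrable_inner,
    integral_add ((integrable_const _).fun_add i2) i1, integral_add (integrable_const _) i2,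
    _root_.integral_inner hπ.integrable_fst, _root_.integral_inner hπ.integrable_snd,
    hπ.mean_fst, hπ.mean_snd]
  simp

/-- The factor N is not cancelled in the constant, so the identity also covers N = 0. -/
theorem localLoss_eq {m d N : ℕ}
    {π : Measure (EuclideanSpace ℝ (Fin m) × EuclideanSpace ℝ (Fin m))} (hπ : IsCenteredNoise π)
    (x : Fin N → EuclideanSpace ℝ (Fin d)) (w : Matrix (Fin m) (Fin d) ℝ) :
    localLoss π x w = gramLoss (empMoment x) w
      - (1 / (N : ℝ)) * (N * ∫ p, ⟪p.1, p.2⟫_ℝ ∂π) := by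
  rw [gramLoss_eq, ← mean_inner_toEuclideanLin, localLoss]
  simp_rw [hπ.integral_inner]
  rw [Finset.sum_add_distrib]
  simp only [Finset.sum_const, Finset.card_univ, Fintype.card_fin, nsmul_eq_mul]
  ring

/-- The weights |D_k|/|D| cancel the local factors 1/|D_k|, so the weighted sum of local averages is
one average over the pooled sample. -/
theorem globalLoss_eq {m d n : ℕ} {N : Fin n → ℕ} (hN : ∀ k, 0 < N k) (hn : 0 < n)
    {π : Fin n → Measure (EuclideanSpace ℝ (Fin m) × EuclideanSpace ℝ (Fin m))}
    (hπ : ∀ k, IsCenteredNoise (π k))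
    (x : (k : Fin n) → Fin (N k) → EuclideanSpace ℝ (Fin d)) :
    ∃ κ : ℝ, ∀ w : Matrix (Fin m) (Fin d) ℝ, globalLoss π x w
      = gramLoss (empMoment fun p : (k : Fin n) × Fin (N k) => x p.1 p.2) w + κ := by
  refine ⟨-∑ k, ((N k : ℝ) / ∑ l, (N l : ℝ)) *
    ((1 / (N k : ℝ)) * (N k * ∫ p, ⟪p.1, p.2⟫_ℝ ∂π k)), fun w => ?_⟩
  have hT : 0 < ∑ l, (N l : ℝ) :=
    Finset.sum_pos (fun l _ => by exact_mod_cast hN l) ⟨⟨0, hn⟩, Finset.mem_univ _⟩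
  unfold globalLoss
  simp_rw [localLoss_eq (hπ _), gramLoss_eq, ← mean_inner_toEuclideanLin, mul_sub, mul_add]
  rw [Finset.sum_sub_distrib, Finset.sum_add_distrib, ← Finset.sum_mul, ← Finset.sum_div,
    div_self hT.ne', one_mul, ← sub_eq_add_neg, Fintype.sum_sigma]
  congr 2
  simp only [Fintype.card_sigma, Fintype.card_fin, Nat.cast_sum, mul_neg, Finset.sum_neg_distrib,
    Finset.mul_sum]
  congr 1
  refine Finset.sum_congr rfl fun k _ => Finset.sum_congr rfl fun s _ => ?_
  have : (N k : ℝ) ≠ 0 := by exact_mod_cast (hN k).ne'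
  field_simp

theorem IsOptimal.of_eq_add_const {m d : ℕ} {L L' : Matrix (Fin m) (Fin d) ℝ → ℝ} {κ : ℝ}
    (h : ∀ w, L w = L' w + κ) {w : Matrix (Fin m) (Fin d) ℝ} (hw : IsOptimal L w) :
    IsOptimal L' w := fun v => by
  have := hw v
  rw [h, h] at this
  linarith

/-! ### Minimizers when the second moment matrix is nearly diagonal. -/

theorem entry_sq_le_frobSq {d : ℕ} (M : Matrix (Fin d) (Fin d) ℝ) (i j : Fin d) :
    M i j ^ 2 ≤ frobSq M := by
  refine le_trans ?_ (Finset.single_le_sum (f := fun i => ∑ j, M i j ^ 2)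
    (fun i _ => Finset.sum_nonneg fun j _ => sq_nonneg _) (Finset.mem_univ i))
  exact Finset.single_le_sum (f := fun j => M i j ^ 2) (fun j _ => sq_nonneg _) (Finset.mem_univ j)

/-- Bounds on the Gram matrix of an optimal `w` when `X` is Frobenius-close to a diagonal matrix
that equals `δ` outside the first `n` coordinates. -/
theorem IsOptimal.gram_bounds {n m d : ℕ} (hnd : n ≤ d) (hnm : n ≤ m) (hm : 0 < m)
    {X : Matrix (Fin d) (Fin d) ℝ} (hX : Xᵀ = X) {D : Fin d → ℝ} {δ L : ℝ} (hδ : 0 ≤ δ)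
    (hXD : frobSq (X - Matrix.diagonal D) ≤ δ ^ 2) (hL : 0 ≤ L) (hD0 : ∀ i, 0 ≤ D i)
    (hDL : ∀ i, D i ≤ L) (hDn : ∀ i : Fin d, n ≤ i.val → D i = δ)
    {w : Matrix (Fin m) (Fin d) ℝ} (hw : IsOptimal (gramLoss X) w) :
    specNorm (wᵀ * w) ≤ L + δ ∧ ∀ i, D i - 3 * δ ≤ (wᵀ * w) i i := by
  set E := X - Matrix.diagonal D with hE
  have hEn : specNorm E ≤ δ := specNorm_le_of_frobSq_le E hδ hXD
  have hXE : X = Matrix.diagonal D + E := by rw [hE]; abel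
  constructor
  · refine (hw.specNorm_gram_le hX).trans ?_
    rw [hXE]
    refine (specNorm_add_le _ _).trans (add_le_add (specNorm_diagonal_le D hL fun i => ?_) hEn)
    rw [abs_of_nonneg (hD0 i)]
    exact hDL i
  · intro i
    -- One δ bounds `D` beyond the first n coordinates and one bounds `E`; the entry E_ii costs the
    -- third δ of the conclusion.
    have h1 := hw.diag_le hnd hnm hm hX (η := δ + δ) (by linarith) (fun v hv => ?_) i
    · have h2 : -δ ≤ E i i :=
        (abs_le.1 (abs_le_of_sq_le_sq ((entry_sq_le_frobSq E i i).trans hXD) hδ)).1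
      rw [hE, Matrix.sub_apply, Matrix.diagonal_apply_eq] at h2
      linarith
    · rw [hXE, Matrix.add_mulVec, dotProduct_add, add_mul]
      refine add_le_add (le_of_eq ?_) ((quadForm_le_specNorm E v).trans ?_)
      · simp only [dotProduct, Matrix.mulVec_diagonal, Finset.mul_sum]
        refine Finset.sum_congr rfl fun j _ => ?_
        by_cases hj : j.val < n
        · have : v j = 0 := hv ⟨j.val, hj⟩
          simp [this]
        · rw [hDn j (not_lt.1 hj)]; ring
      · exact mul_le_mul_of_nonneg_right hEn (dotProduct_self_real_nonneg v)

/-! ### Direction fractions and the resulting Gram bounds. -/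

/-- The fraction of the labels `y` that have direction `j`. -/
def dirFrac {ι : Type*} [Fintype ι] {n : ℕ} (y : ι → Fin (2 * n)) (j : Fin n) : ℝ :=
  (1 / (Fintype.card ι : ℝ)) * ∑ s, if j = classDir (y s) then (1 : ℝ) else 0

section AvgDiag

variable {ι : Type*} [Fintype ι] {n d : ℕ}

theorem dirFrac_nonneg (y : ι → Fin (2 * n)) (j : Fin n) : 0 ≤ dirFrac y j := by
  unfold dirFrac
  refine mul_nonneg (by positivity) (Finset.sum_nonneg fun s _ => ?_)
  split_ifs <;> norm_num

theorem avgDiag_of_le [Nonempty ι] (y : ι → Fin (2 * n)) (i : Fin d) (hi : n ≤ i.val) :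
    avgDiag y i = (d : ℝ) ^ (-(2 / 5) : ℝ) := by
  have hc : (Fintype.card ι : ℝ) ≠ 0 := by exact_mod_cast Fintype.card_ne_zero
  simp only [avgDiag, classDiag, not_lt.2 hi, dite_false, add_zero, Finset.sum_const,
    Finset.card_univ, nsmul_eq_mul]
  field_simp

theorem avgDiag_castLE [Nonempty ι] (hnd : n ≤ d) (y : ι → Fin (2 * n)) (j : Fin n) :
    avgDiag y (Fin.castLE hnd j) = (d : ℝ) ^ (-(2 / 5) : ℝ) + (d : ℝ) ^ (2 / 5 : ℝ)
      - dirFrac y j * ((d : ℝ) ^ (2 / 5 : ℝ) - 1) := by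
  have hc : (Fintype.card ι : ℝ) ≠ 0 := by exact_mod_cast Fintype.card_ne_zero
  have e : ∀ s, classDiag (y s) (Fin.castLE hnd j)
      = ((d : ℝ) ^ (-(2 / 5) : ℝ) + (d : ℝ) ^ (2 / 5 : ℝ))
        - (if j = classDir (y s) then (1 : ℝ) else 0) * ((d : ℝ) ^ (2 / 5 : ℝ) - 1) := by
    intro s
    simp only [classDiag, Fin.val_castLE, j.2, dite_true, Fin.eta]
    split_ifs <;> ring
  unfold avgDiag dirFrac
  simp_rw [e]
  rw [Finset.sum_sub_distrib, ← Finset.sum_mul, Finset.sum_const, Finset.card_univ, nsmul_eq_mul]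
  field_simp

theorem le_avgDiag [Nonempty ι] (y : ι → Fin (2 * n)) (i : Fin d) :
    (d : ℝ) ^ (-(2 / 5) : ℝ) ≤ avgDiag y i := by
  have hc : (0 : ℝ) < Fintype.card ι := by exact_mod_cast Fintype.card_pos
  rw [avgDiag, one_div, ← div_eq_inv_mul, le_div_iff₀ hc]
  have : ∑ _s : ι, (d : ℝ) ^ (-(2 / 5) : ℝ) ≤ ∑ s, classDiag (y s) i := by
    refine Finset.sum_le_sum fun s _ => ?_
    unfold classDiag
    split_ifs
    · linarith
    · have : 0 ≤ (d : ℝ) ^ (2 / 5 : ℝ) := by positivity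
      linarith
    · linarith
  rw [Finset.sum_const, Finset.card_univ, nsmul_eq_mul] at this
  linarith

theorem le_avgDiag_castLE [Nonempty ι] (hnd : n ≤ d) (y : ι → Fin (2 * n))
    (j : Fin n) {f : ℝ} (hf : dirFrac y j ≤ f) :
    (d : ℝ) ^ (2 / 5 : ℝ) - f * (d : ℝ) ^ (2 / 5 : ℝ) ≤ avgDiag y (Fin.castLE hnd j) := by
  rw [avgDiag_castLE]
  have h1 : 0 ≤ (d : ℝ) ^ (2 / 5 : ℝ) := by positivity
  have h2 : 0 ≤ (d : ℝ) ^ (-(2 / 5) : ℝ) := by positivity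
  nlinarith [dirFrac_nonneg y j]

theorem avgDiag_castLE_le [Nonempty ι] (hnd : n ≤ d) (hd : 0 < d) (y : ι → Fin (2 * n))
    (j : Fin n) {f : ℝ} (hf : f ≤ dirFrac y j) :
    avgDiag y (Fin.castLE hnd j) ≤ (d : ℝ) ^ (-(2 / 5) : ℝ) + (d : ℝ) ^ (2 / 5 : ℝ)
      - f * ((d : ℝ) ^ (2 / 5 : ℝ) - 1) := by
  rw [avgDiag_castLE]
  have h1 : 1 ≤ (d : ℝ) ^ (2 / 5 : ℝ) := Real.one_le_rpow (by exact_mod_cast hd) (by norm_num)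
  gcongr

end AvgDiag

theorem sum_dir_le_offClassCount {n N : ℕ} {k j : Fin n} (hjk : j ≠ k) (y : Fin N → Fin (2 * n)) :
    ∑ s, (if j = classDir (y s) then (1 : ℝ) else 0) ≤ offClassCount k y := by
  rw [offClassCount, Finset.card_filter, Nat.cast_sum]
  refine Finset.sum_le_sum fun s _ => ?_
  by_cases h : j = classDir (y s)
  · have : classDir (y s) ≠ k := h ▸ hjk
    simp [h, this]
  · rw [if_neg h]
    exact Nat.cast_nonneg _

theorem sum_dir_self {n N : ℕ} (k : Fin n) (y : Fin N → Fin (2 * n)) :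
    ∑ s, (if k = classDir (y s) then (1 : ℝ) else 0) = N - offClassCount k y := by
  rw [eq_sub_iff_add_eq, offClassCount, Finset.card_filter, Nat.cast_sum, ← Finset.sum_add_distrib]
  have : ∀ s, ((if k = classDir (y s) then (1 : ℝ) else 0)
      + ((if classDir (y s) ≠ k then 1 else 0 : ℕ) : ℝ)) = 1 := by
    intro s
    by_cases h : k = classDir (y s)
    · simp [← h]
    · have h' : classDir (y s) ≠ k := fun e => h e.symm
      simp [h, h']
  rw [Finset.sum_congr rfl fun s _ => this s]
  simp

/-- If the labels of direction `j` are a fraction at least `f` of the whole for each `j`, the Gram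
matrix of an optimal `w` is bounded accordingly, as soon as the empirical second moments are close
to their means. -/
theorem IsOptimal.sample_bounds {ι : Type*} [Fintype ι] [Nonempty ι] {n m d : ℕ} (hnd : n ≤ d)
    (hn : 0 < n) (hnm : n ≤ m) (hd : 0 < d) (y : ι → Fin (2 * n))
    {x : ι → EuclideanSpace ℝ (Fin d)}
    (hx : frobSq (empMoment x - Matrix.diagonal (avgDiag y)) < ((d : ℝ) ^ (-(2 / 5) : ℝ)) ^ 2)
    {f : ℝ} (hf : ∀ j, f ≤ dirFrac y j) {w : Matrix (Fin m) (Fin d) ℝ}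
    (hw : IsOptimal (gramLoss (empMoment x)) w) :
    specNorm (wᵀ * w) ≤ (d : ℝ) ^ (2 / 5 : ℝ) - f * ((d : ℝ) ^ (2 / 5 : ℝ) - 1)
        + 2 * (d : ℝ) ^ (-(2 / 5) : ℝ) ∧
      ∀ (j : Fin n) (g : ℝ), dirFrac y j ≤ g →
        (d : ℝ) ^ (2 / 5 : ℝ) - g * (d : ℝ) ^ (2 / 5 : ℝ) - 3 * (d : ℝ) ^ (-(2 / 5) : ℝ)
          ≤ (wᵀ * w) (Fin.castLE hnd j) (Fin.castLE hnd j) := by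
  have hμ : 0 ≤ (d : ℝ) ^ (-(2 / 5) : ℝ) := by positivity
  have hle := fun j : Fin n =>
    avgDiag_castLE_le hnd hd y j (hf j)
  -- Comparison at coordinate 0 puts d^{-2/5}, the diagonal value beyond the first n coordinates,
  -- below the same upper bound.
  have hL := (le_avgDiag y (Fin.castLE hnd ⟨0, hn⟩)).trans (hle ⟨0, hn⟩)
  have hDL : ∀ i : Fin d, avgDiag y i ≤ (d : ℝ) ^ (-(2 / 5) : ℝ) + (d : ℝ) ^ (2 / 5 : ℝ)
      - f * ((d : ℝ) ^ (2 / 5 : ℝ) - 1) := by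
    intro i
    by_cases hi : i.val < n
    · exact hle ⟨i.val, hi⟩
    · rw [avgDiag_of_le y i (not_lt.1 hi)]
      exact hL
  obtain ⟨h1, h2⟩ := hw.gram_bounds hnd hnm (hn.trans_le hnm) (empMoment_transpose x) hμ hx.le
    (hμ.trans hL) (fun i => hμ.trans (le_avgDiag y i)) hDL (fun i hi => avgDiag_of_le y i hi)
  refine ⟨by linarith, fun j g hg => ?_⟩
  have h3 := le_avgDiag_castLE hnd y j hg
  linarith [h2 (Fin.castLE hnd j)]

theorem dirFrac_le_of_offClassCount_le {n N : ℕ} (hN : 0 < N) {k j : Fin n} (hjk : j ≠ k)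
    (y : Fin N → Fin (2 * n)) {θ : ℝ} (h : (offClassCount k y : ℝ) ≤ θ * N) :
    dirFrac y j ≤ θ := by
  have hN' : (0 : ℝ) < N := by exact_mod_cast hN
  rw [dirFrac, Fintype.card_fin, one_div, ← div_eq_inv_mul, div_le_iff₀ hN']
  exact (sum_dir_le_offClassCount hjk y).trans h

section Global

variable {n : ℕ} {N : Fin n → ℕ} {y : (k : Fin n) → Fin (N k) → Fin (2 * n)} {θ : ℝ}

theorem dirFrac_sigma (j : Fin n) :
    dirFrac (fun p : (k : Fin n) × Fin (N k) => y p.1 p.2) j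
      = (∑ k, ∑ s, if j = classDir (y k s) then (1 : ℝ) else 0) / ∑ l, (N l : ℝ) := by
  rw [dirFrac, Fintype.sum_sigma, Fintype.card_sigma, Nat.cast_sum, one_div, ← div_eq_inv_mul]
  simp

/-- Client j contributes at most all of its samples, every other client at most a fraction θ of its
own. -/
theorem dirFrac_sigma_le (hN : ∀ k, 0 < N k) (hθ : 0 ≤ θ)
    (h : ∀ k, (offClassCount k (y k) : ℝ) ≤ θ * N k) (j : Fin n) :
    dirFrac (fun p : (k : Fin n) × Fin (N k) => y p.1 p.2) j
      ≤ (N j : ℝ) / ∑ l, (N l : ℝ) + θ := by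
  have hT : 0 < ∑ l, (N l : ℝ) :=
    Finset.sum_pos (fun l _ => by exact_mod_cast hN l) ⟨j, Finset.mem_univ _⟩
  rw [dirFrac_sigma, div_add' _ _ _ hT.ne']
  refine div_le_div_of_nonneg_right ?_ hT.le
  have hk : ∀ k, ∑ s, (if j = classDir (y k s) then (1 : ℝ) else 0)
      ≤ (if k = j then (N k : ℝ) else 0) + θ * N k := by
    intro k
    have h0 : (0 : ℝ) ≤ N k := Nat.cast_nonneg _
    by_cases hkj : k = j
    · subst hkj
      rw [sum_dir_self, if_pos rfl]
      have : (0 : ℝ) ≤ offClassCount k (y k) := Nat.cast_nonneg _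
      nlinarith
    · rw [if_neg hkj, zero_add]
      exact (sum_dir_le_offClassCount (fun e => hkj e.symm) (y k)).trans (h k)
  refine (Finset.sum_le_sum fun k _ => hk k).trans (le_of_eq ?_)
  rw [Finset.sum_add_distrib, ← Finset.mul_sum]
  simp

/-- The samples of direction j held by client j alone suffice. -/
theorem le_dirFrac_sigma (hN : ∀ k, 0 < N k)
    (h : ∀ k, (offClassCount k (y k) : ℝ) ≤ θ * N k) (j : Fin n) :
    (1 - θ) * ((N j : ℝ) / ∑ l, (N l : ℝ))
      ≤ dirFrac (fun p : (k : Fin n) × Fin (N k) => y p.1 p.2) j := by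
  have hT : 0 < ∑ l, (N l : ℝ) :=
    Finset.sum_pos (fun l _ => by exact_mod_cast hN l) ⟨j, Finset.mem_univ _⟩
  rw [dirFrac_sigma, ← mul_div_assoc]
  refine div_le_div_of_nonneg_right ?_ hT.le
  refine le_trans ?_ (Finset.single_le_sum
    (f := fun k => ∑ s, if j = classDir (y k s) then (1 : ℝ) else 0)
    (fun k _ => Finset.sum_nonneg fun s _ => by split_ifs <;> norm_num) (Finset.mem_univ j))
  rw [sum_dir_self]
  linarith [h j]

end Global

end FedSSL

end

/-! ### Choice of constants and conclusion. -/

theorem theorem2 (γ A c₁ c₂ b₁ b₂ : ℝ) (hγ : 0 < γ) (hc₁ : 0 < c₁) (hb₁ : 0 < b₁) :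
    ∃ (a b C : ℝ) (d₀ : ℕ), 0 < a ∧ a ≤ b ∧ 0 < C ∧
      ∀ (d n m : ℕ) (hnd : n ≤ d), d₀ ≤ d → n ≤ m →
      -- `n = Θ(d^{1/20})`
      c₁ * (d : ℝ) ^ (1 / 20 : ℝ) ≤ n → (n : ℝ) ≤ c₂ * (d : ℝ) ^ (1 / 20 : ℝ) →
      -- sizes `N k` of the local data sets and labels `y k` of their samples
      ∀ (N : Fin n → ℕ) (y : (k : Fin n) → Fin (N k) → Fin (2 * n)),
      (∀ k, (d : ℝ) ^ (2 + γ) ≤ N k) →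
      (∀ k, b₁ / n ≤ (N k : ℝ) / ∑ l, (N l : ℝ) ∧ (N k : ℝ) / ∑ l, (N l : ℝ) ≤ b₂ / n) →
      (∀ k, (FedSSL.offClassCount k (y k) : ℝ) ≤ A * (d : ℝ) ^ (-(4 / 5) : ℝ) * N k) →
      -- the noise in the objectives
      ∀ (π : Fin n → Measure (EuclideanSpace ℝ (Fin m) × EuclideanSpace ℝ (Fin m))),
      (∀ k, FedSSL.IsCenteredNoise (π k)) →
      -- the random data
      ∀ {Ω : Type*} [MeasurableSpace Ω] (P : Measure Ω) [IsProbabilityMeasure P]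
        (x : (k : Fin n) → Fin (N k) → Ω → EuclideanSpace ℝ (Fin d)),
      (∀ k s, HasLaw (x k s) (FedSSL.classLaw hnd (y k s)) P) →
      iIndepFun (fun p : (k : Fin n) × Fin (N k) => x p.1 p.2) P →
      -- the local models
      (∀ k : Fin n,
        P {ω | ¬ ∀ w ε : Matrix (Fin m) (Fin d) ℝ,
            FedSSL.IsOptimal (FedSSL.localLoss (π k) (fun s => x k s ω)) w →
            ∀ i : Fin n, i ≠ k →
              ((d : ℝ) ^ (2 / 5 : ℝ) - C * (d : ℝ) ^ (-(2 / 5) : ℝ)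
                  + FedSSL.diagPerturbation w ε (Fin.castLE hnd i))
                / ((d : ℝ) ^ (2 / 5 : ℝ) + C * (d : ℝ) ^ (-(2 / 5) : ℝ)
                  + FedSSL.normPerturbation w ε)
                ≤ FedSSL.representability (w + ε) (Fin.castLE hnd i) ∧
              FedSSL.representability (w + ε) (Fin.castLE hnd i) ≤ 1}
          ≤ ENNReal.ofReal (C * (d : ℝ) ^ (-γ))) ∧
      -- the global model (its denominator is positive)
      0 < (d : ℝ) ^ (2 / 5 : ℝ) - a * (d : ℝ) ^ (7 / 20 : ℝ) + C * (d : ℝ) ^ (-(1 / 20) : ℝ) ∧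
      P {ω | ¬ ∀ w ε : Matrix (Fin m) (Fin d) ℝ,
          FedSSL.IsOptimal (FedSSL.globalLoss π (fun k s => x k s ω)) w →
          ∀ i : Fin n,
            ((d : ℝ) ^ (2 / 5 : ℝ) - b * (d : ℝ) ^ (7 / 20 : ℝ) - C * (d : ℝ) ^ (-(1 / 20) : ℝ)
                - C * (d : ℝ) ^ (-(2 / 5) : ℝ)
                + FedSSL.diagPerturbation w ε (Fin.castLE hnd i))
              / ((d : ℝ) ^ (2 / 5 : ℝ) - a * (d : ℝ) ^ (7 / 20 : ℝ)
                + C * (d : ℝ) ^ (-(1 / 20) : ℝ) + FedSSL.normPerturbation w ε)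
              ≤ FedSSL.representability (w + ε) (Fin.castLE hnd i) ∧
            FedSSL.representability (w + ε) (Fin.castLE hnd i) ≤ 1}
        ≤ ENNReal.ofReal (C * (d : ℝ) ^ (-γ)) := by
  -- Only 1 - θ ≥ 1/2 is needed from large d, where θ = |A|d^{-4/5} bounds the off-class fractions.
  obtain ⟨d₀, hd₀⟩ : ∃ d₀ : ℕ, ∀ d : ℕ, d₀ ≤ d → |A| * (d : ℝ) ^ (-(4 / 5) : ℝ) ≤ 1 / 2 := by
    have h1 : Filter.Tendsto (fun d : ℕ => |A| * (d : ℝ) ^ (-(4 / 5) : ℝ)) Filter.atTop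
        (nhds (|A| * 0)) :=
      ((tendsto_rpow_neg_atTop (by norm_num : (0 : ℝ) < 4 / 5)).comp
        tendsto_natCast_atTop_atTop).const_mul |A|
    rw [mul_zero] at h1
    exact Filter.eventually_atTop.1 (h1.eventually_le_const (by norm_num))
  have hc : 0 < max c₁ c₂ := lt_max_of_lt_left hc₁
  -- The fraction b₁/n is at least b₁d^{-1/20}/max c₁ c₂, and the factor 2 pays for 1 - θ. The
  -- maximum makes the denominator positive through c₁.
  set a : ℝ := b₁ / (2 * max c₁ c₂) with ha
  have ha0 : 0 < a := by positivity
  set K : ℝ := 8 * (c₂ ^ 4 + FedSSL.gaussianFourthMoment) with hK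
  have hK0 : 0 ≤ K := by
    have := FedSSL.gaussianFourthMoment_nonneg
    positivity
  have hA0 : 0 ≤ |A| := abs_nonneg A
  -- `K` serves the failure probability; |A| + 3 collects the off-class loss |A|μ² and the error
  -- 3μ²; a + 3 covers the term a·d^{-1/20} left by the -1 in f(τ² - 1) and 2μ² ≤ 2d^{-1/20}.
  set C : ℝ := K + |A| + a + 3 with hC
  have hC0 : 0 < C := by positivity
  refine ⟨a, max a (b₂ / c₁), C, max d₀ 1, ha0, le_max_left _ _, hC0, ?_⟩
  intro d n m hnd hdd hnm hn1 hn2 N y hN hp hoff π hπ Ω _ P _ x hlaw hind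
  have hd : 0 < d := (le_max_right d₀ 1).trans hdd
  have hθ : |A| * (d : ℝ) ^ (-(4 / 5) : ℝ) ≤ 1 / 2 := hd₀ d ((le_max_left d₀ 1).trans hdd)
  have hdR : (0 : ℝ) < d := by exact_mod_cast hd
  have hd1 : (1 : ℝ) ≤ d := by exact_mod_cast hd
  have hr : 0 < (d : ℝ) ^ (1 / 20 : ℝ) := by positivity
  have hnR : (0 : ℝ) < n := lt_of_lt_of_le (by positivity) hn1
  have hn : 0 < n := by exact_mod_cast hnR
  have hNpos : ∀ k, 0 < N k := fun k => by
    have : (0 : ℝ) < N k := lt_of_lt_of_le (by positivity) (hN k)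
    exact_mod_cast this
  set θ : ℝ := |A| * (d : ℝ) ^ (-(4 / 5) : ℝ) with hθdef
  have hθ0 : 0 ≤ θ := by positivity
  have hoff' : ∀ k, (FedSSL.offClassCount k (y k) : ℝ) ≤ θ * N k := fun k => by
    refine (hoff k).trans ?_
    rw [hθdef]
    gcongr
    exact le_abs_self A
  set μ2 := (d : ℝ) ^ (-(2 / 5) : ℝ) with hμ2
  set τ2 := (d : ℝ) ^ (2 / 5 : ℝ) with hτ2
  have hμ0 : 0 < μ2 := by positivity
  have hτ1 : 1 ≤ τ2 := Real.one_le_rpow hd1 (by norm_num)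
  -- The exponent -4/5 brings the off-class loss to the order μ² of the sampling error.
  have hθτ : θ * τ2 = |A| * μ2 := by
    rw [hθdef, hτ2, hμ2, mul_assoc, ← Real.rpow_add hdR]
    norm_num
  have hKC : K * (d : ℝ) ^ (-γ) ≤ C * (d : ℝ) ^ (-γ) := by
    gcongr
    linarith
  refine ⟨fun k => ?_, ?_⟩
  · -- the local models
    have : Nonempty (Fin (N k)) := ⟨⟨0, hNpos k⟩⟩
    have hindk : iIndepFun (x k) P :=
      hind.precomp (g := fun s : Fin (N k) => (⟨k, s⟩ : (k : Fin n) × Fin (N k)))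
        fun s t hst => eq_of_heq (Sigma.mk.inj hst).2
    have hbad := FedSSL.measure_frobSq_classSample_ge_le hnd hd hn2
      (by simpa using hN k) (y k) (hlaw k) hindk
    -- Failure is contained in the deviation event, so monotonicity of the outer measure suffices
    -- and measurability is not needed.
    refine le_trans (measure_mono ?_) (hbad.trans (ENNReal.ofReal_le_ofReal hKC))
    intro ω hω
    by_contra hgood
    refine hω fun w ε hw i hik => ⟨?_, FedSSL.representability_le_one _ _⟩
    have hw' : FedSSL.IsOptimal (FedSSL.gramLoss (FedSSL.empMoment fun s => x k s ω)) w :=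
      hw.of_eq_add_const fun v => by
        rw [FedSSL.localLoss_eq (hπ k), sub_eq_add_neg]
    -- Here f = 0: some directions may be absent from a client's data, so the norm bound has no
    -- saving.
    obtain ⟨h1, h2⟩ := hw'.sample_bounds hnd hn hnm hd (y k) (not_le.1 hgood)
      (FedSSL.dirFrac_nonneg (y k))
    have h3 := h2 i θ (FedSSL.dirFrac_le_of_offClassCount_le (hNpos k) hik (y k) (hoff' k))
    rw [← hτ2, ← hμ2] at h1 h3
    have hCμ : (|A| + 3) * μ2 ≤ C * μ2 := by
      gcongr
      linarith
    have hAμ : 0 ≤ |A| * μ2 := by positivity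
    refine FedSSL.div_le_representability w ε _ (by positivity) ?_ ?_
    · rw [hθτ] at h3
      linarith
    · linarith
  · -- the global model
    have hj0 : Nonempty ((k : Fin n) × Fin (N k)) := ⟨⟨⟨0, hn⟩, ⟨0, hNpos _⟩⟩⟩
    set Y : (k : Fin n) × Fin (N k) → Fin (2 * n) := fun p => y p.1 p.2 with hY
    set s20 := (d : ℝ) ^ (-(1 / 20) : ℝ) with hs20
    have hs0 : 0 < s20 := by positivity
    have hsr : s20 * (d : ℝ) ^ (1 / 20 : ℝ) = 1 := by
      rw [hs20, ← Real.rpow_add hdR]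
      norm_num
    have hsτ : s20 * τ2 = (d : ℝ) ^ (7 / 20 : ℝ) := by
      rw [hs20, hτ2, ← Real.rpow_add hdR]
      norm_num
    have hμs : μ2 ≤ s20 := Real.rpow_le_rpow_of_exponent_le hd1 (by norm_num)
    have hlow : ∀ j, a * s20 ≤ FedSSL.dirFrac Y j := by
      intro j
      refine le_trans ?_ (FedSSL.le_dirFrac_sigma hNpos hoff' j)
      have h1 : b₁ / n ≤ (N j : ℝ) / ∑ l, (N l : ℝ) := (hp j).1
      have h2 : b₁ / max c₁ c₂ * s20 ≤ b₁ / n := by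
        rw [div_mul_eq_mul_div, div_le_div_iff₀ hc hnR, mul_assoc]
        refine mul_le_mul_of_nonneg_left ?_ hb₁.le
        calc s20 * n ≤ s20 * (max c₁ c₂ * (d : ℝ) ^ (1 / 20 : ℝ)) := by
              gcongr
              exact hn2.trans (by gcongr; exact le_max_right _ _)
          _ = max c₁ c₂ * (s20 * (d : ℝ) ^ (1 / 20 : ℝ)) := by ring
          _ = max c₁ c₂ := by rw [hsr, mul_one]
      have h3 : a * s20 = (1 / 2) * (b₁ / max c₁ c₂ * s20) := by
        rw [ha]
        field_simp
      rw [h3]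
      refine mul_le_mul (by linarith) (h2.trans h1) (by positivity) (by linarith)
    have hup : ∀ j, FedSSL.dirFrac Y j ≤ max a (b₂ / c₁) * s20 + θ := by
      intro j
      refine (FedSSL.dirFrac_sigma_le hNpos hθ0 hoff' j).trans ?_
      gcongr
      refine (hp j).2.trans ?_
      have hb₂ : 0 < b₂ := by
        have := (hp j).1.trans (hp j).2
        rw [div_le_div_iff_of_pos_right hnR] at this
        linarith
      calc b₂ / n ≤ b₂ / c₁ * s20 := by
            rw [div_mul_eq_mul_div, div_le_div_iff₀ hnR hc₁, mul_assoc]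
            refine mul_le_mul_of_nonneg_left ?_ hb₂.le
            calc c₁ = s20 * (c₁ * (d : ℝ) ^ (1 / 20 : ℝ)) := by
                  rw [mul_left_comm, hsr, mul_one]
              _ ≤ s20 * n := by gcongr
        _ ≤ _ := by
            gcongr
            exact le_max_right _ _
    have hCs : (a + 3) * s20 ≤ C * s20 := by
      gcongr
      linarith
    -- The first diagonal entry lies between μ² and μ² + τ² - a·d^{-1/20}(τ² - 1), so τ² -
    -- a·d^{7/20} + a·d^{-1/20} ≥ 0; C > a makes this strict.
    have hden : 0 < τ2 - a * (d : ℝ) ^ (7 / 20 : ℝ) + C * s20 := by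
      have h1 := (FedSSL.le_avgDiag Y (Fin.castLE hnd ⟨0, hn⟩)).trans
        (FedSSL.avgDiag_castLE_le hnd hd Y ⟨0, hn⟩ (hlow ⟨0, hn⟩))
      rw [← hτ2, ← hμ2] at h1
      rw [← hsτ]
      linarith
    refine ⟨hden, ?_⟩
    have hcard : (d : ℝ) ^ (2 + γ) ≤ Fintype.card ((k : Fin n) × Fin (N k)) := by
      rw [Fintype.card_sigma, Nat.cast_sum]
      simp only [Fintype.card_fin]
      exact (hN ⟨0, hn⟩).trans (Finset.single_le_sum (f := fun k => (N k : ℝ))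
        (fun k _ => Nat.cast_nonneg _) (Finset.mem_univ _))
    have hbad := FedSSL.measure_frobSq_classSample_ge_le hnd hd hn2 hcard Y
      (fun p => hlaw p.1 p.2) hind
    refine le_trans (measure_mono ?_) (hbad.trans (ENNReal.ofReal_le_ofReal hKC))
    intro ω hω
    by_contra hgood
    refine hω fun w ε hw i => ⟨?_, FedSSL.representability_le_one _ _⟩
    obtain ⟨κ, hκ⟩ := FedSSL.globalLoss_eq (m := m) hNpos hn hπ (fun k s => x k s ω)
    obtain ⟨h1, h2⟩ := (hw.of_eq_add_const hκ).sample_bounds hnd hn hnm hd Y (not_le.1 hgood) hlow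
    have h3 := h2 i _ (hup i)
    rw [← hτ2, ← hμ2] at h1 h3
    have hCμ : (|A| + 3) * μ2 ≤ C * μ2 := by
      gcongr
      linarith
    have hCs0 : 0 ≤ C * s20 := by positivity
    refine FedSSL.div_le_representability w ε _ hden ?_ ?_
    · rw [add_mul, hθτ, mul_assoc, hsτ] at h3
      linarith
    · rw [← hsτ]
      linarith
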